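/- Let $S=\{1,\dots,d\}$ and let $\mathcal M(S\times S)$ be the set of Markov distributions on $S\times S$, that is, of the $\nu=[\nu(i,j)]$ with $\nu(i,j)\ge 0$, $\sum_{i,j}\nu(i,j)=1$ and $\nu(k,*):=\sum_j\nu(k,j)=\sum_i\nu(i,k)$ for all $k\in S$. Put $\nu(j|i):=\nu(i,j)/\nu(i,*)$ if $\nu(i,*)>0$, and $\nu(j|i):=0$ for all $j$ otherwise. For a $d\times d$ matrix $M$ with nonnegative entries let $$\rho(M):=\lim_{n\to\infty}\frac1n\log\sum_{i,j}(M^n)_{ij}\in[-\infty,\infty)$$ be its growth rate. For probability mass functions $p,q$ on a finite set and $\alpha>0$, $\alpha\ne1$, put $R_\alpha(p\|q):=\infty$ if $\alpha>1$ and $p\not\preceq q$ (i.e. $q(x)=0<p(x)$ for some $x$), and $R_\alpha(p\|q):=\frac{1}{\alpha(\alpha-1)}\log\sum_{x:\,p(x)q(x)>0}\big(\tfrac{p(x)}{q(x)}\big)^\alpha q(x)$ otherwise (with $\log 0=-\infty$); for $\alpha<0$ put $R_\alpha(p\|q):=R_{1-\alpha}(q\|p)$. For $\nu\in\mathcal M(S\times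 S)$ let $\nu_n$ be the law on $S^n$ of the stationary Markov chain defined by $\nu$: $\nu_1(k)=\nu(k,*)$ and $\nu_n(i_1,\dots,i_n)=\nu(i_1,i_2)\prod_{k=2}^{n-1}\nu(i_{k+1}|i_k)$ for $n\ge2$. For $\nu,\theta\in\mathcal M(S\times S)$ and $\alpha\in\mathbb R\setminus\{0,1\}$ let $$R_\alpha(\nu\|\theta):=\lim_{n\to\infty}\frac1n R_\alpha(\nu_n\|\theta_n)\in[0,\infty]$$ be the Rényi divergence rate. Theorem. Let $\alpha\in\mathbb R\setminus\{0,1\}$ and let $G=[g(i,j)]\in\mathbb R^{d\times d}$. The limits defining $\rho(M)$, for every nonnegative $d\times d$ matrix $M$, and $R_\alpha(\nu\|\theta)$, for all $\nu,\theta\in\mathcal M(S\times S)$, exist in $[-\infty,\infty]$, and $\rho([e^{c\,g(i,j)}\nu(j|i)])$ is finite for every $\nu\in\mathcal M(S\times S)$ and $c\in\mathbb R$. For every $\nu\in\mathcal M(S\times S)$, $$\frac{1}{\alpha-1}\,\rho\big([e^{(\alpha-1)g(i,j)}\nu(j|i)]\big)=\inf_{\theta\in\mathcal M(S\times S)}\Big(\frac1\alpha\,\rho\big([e^{\alpha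 g(i,j)}\theta(j|i)]\big)+R_\alpha(\nu\|\theta)\Big),$$ and for every $\theta\in\mathcal M(S\times S)$, $$\frac1\alpha\,\rho\big([e^{\alpha g(i,j)}\theta(j|i)]\big)=\sup_{\nu\in\mathcal M(S\times S)}\Big(\frac{1}{\alpha-1}\,\rho\big([e^{(\alpha-1)g(i,j)}\nu(j|i)]\big)-R_\alpha(\nu\|\theta)\Big).$$ -/

import Mathlib

open Filter Topology

noncomputable section

/-- The Markov probability distributions on `S × S`, `S = {1, …, d}`: nonnegative, of total mass
one, and with equal first and second marginals. -/
def MarkovDist (d : ℕ) : Set (Matrix (Fin d) (Fin d) ℝ) :=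
  {ν | (∀ i j, 0 ≤ ν i j) ∧ ∑ i, ∑ j, ν i j = 1 ∧ ∀ k, ∑ j, ν k j = ∑ i, ν i k}

/-- The transition probability `ν(j|i)`, with the convention that it is `0` for all `j` if `i` is
not in the support of `ν`. -/
def condProb {d : ℕ} (ν : Matrix (Fin d) (Fin d) ℝ) (i j : Fin d) : ℝ :=
  if 0 < ∑ k, ν i k then ν i j / ∑ k, ν i k else 0

/-- The extended-real logarithm of a nonnegative real number, with value `-∞` at `0`. -/
def elog (x : ℝ) : EReal := ENNReal.log (ENNReal.ofReal x)

/-- The sequence `(1/n) log ∑ᵢⱼ (Mⁿ)ᵢⱼ`. -/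
def growthSeq {d : ℕ} (M : Matrix (Fin d) (Fin d) ℝ) (n : ℕ) : EReal :=
  ((1 / (n : ℝ) : ℝ) : EReal) * elog (∑ i, ∑ j, (M ^ n) i j)

/-- The growth rate `ρ(M)` of a matrix with nonnegative entries. -/
def growthRate {d : ℕ} (M : Matrix (Fin d) (Fin d) ℝ) : EReal :=
  limUnder atTop (growthSeq M)

/-- The law `νₙ` on `Sⁿ` of the first `n` states of the stationary Markov chain defined by `ν`. -/
def chainLaw {d : ℕ} (ν : Matrix (Fin d) (Fin d) ℝ) : (n : ℕ) → (Fin n → Fin d) → ℝ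
  | 0, _ => 1
  | 1, x => ∑ j, ν (x 0) j
  | n + 2, x => ν (x 0) (x 1) * ∏ k : Fin n, condProb ν (x k.castSucc.succ) (x k.succ.succ)

/-- Rényi divergence of order `α > 0`, `α ≠ 1`, between probability mass functions on a finite
set. -/
def renyiPos {X : Type*} [Fintype X] (α : ℝ) (p q : X → ℝ) : EReal :=
  open Classical in
  if 1 < α ∧ ¬ ∀ x, q x = 0 → p x = 0 then ⊤
  else ((1 / (α * (α - 1)) : ℝ) : EReal) *
    elog (∑ x with 0 < p x * q x, (p x / q x) ^ α * q x)

/-- Rényi divergence of order `α ≠ 0, 1` between probability mass functions on a finite set; for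
`α < 0` it is the divergence of order `1 - α` with the arguments interchanged. -/
def renyiDiv {X : Type*} [Fintype X] (α : ℝ) (p q : X → ℝ) : EReal :=
  if 0 < α then renyiPos α p q else renyiPos (1 - α) q p

/-- The sequence `(1/n) R_α(νₙ ‖ θₙ)`. -/
def renyiSeq {d : ℕ} (α : ℝ) (ν θ : Matrix (Fin d) (Fin d) ℝ) (n : ℕ) : EReal :=
  ((1 / (n : ℝ) : ℝ) : EReal) * renyiDiv α (chainLaw ν n) (chainLaw θ n)

/-- The Rényi divergence rate `R_α(ν ‖ θ)` between two stationary Markov chains. -/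
def renyiRate {d : ℕ} (α : ℝ) (ν θ : Matrix (Fin d) (Fin d) ℝ) : EReal :=
  limUnder atTop (renyiSeq α ν θ)

/-- The matrix `[e^{c g(i,j)} ν(j|i)]`. -/
def expTilt {d : ℕ} (c : ℝ) (G ν : Matrix (Fin d) (Fin d) ℝ) : Matrix (Fin d) (Fin d) ℝ :=
  Matrix.of fun i j => Real.exp (c * G i j) * condProb ν i j

end

/-! Both sides are growth rates of nonnegative matrices. The total of the entries of `M ^ n` is
submultiplicative, so Fekete's lemma gives the limit `growthExp M` unless some power vanishes. A
path probability is a product of transitions, so the Rényi sum over paths is, up to bounded factors,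
the total of a power of `renyiMat α ν θ`, with entries `ν(j|i)^α θ(j|i)^(1-α)`. For positive order
the divergence rate is therefore either infinite or `growthExp (renyiMat α ν θ) / (α(α-1))`.

One inequality is Hölder's. The matrices `e^{(α-1)g}ν`, `e^{αg}θ` and `ν^α θ^(1-α)` are related
entrywise by a weighted geometric mean, and the growth rate is log-convex
(`growthExp_le_of_le_rpow_mul_rpow`, `growthExp_expTilt_le`). Negative orders follow from the
duality `(α, g, ν, θ) ↦ (1-α, -g, θ, ν)`, which also turns the infimum formula into the supremum
formula.

For the reverse inequality the candidate is the Markov chain `θ(j|i) = N i j * w j / (κ * w i)` with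
`N = e^{-g}ν` and `w` a Perron eigenvector. Up to diagonal similarity and powers of `κ`, both
`e^{αg}θ` and `ν^α θ^(1-α)` then equal `e^{(α-1)g}ν`, and the powers of `κ` cancel. But `N` may be
reducible. For `α > 0` a small constant is added to its entries, at small cost by upper
semicontinuity of the growth rate (`exists_near_minimizer_of_pos`). For `α < 0` finiteness of the
divergence forces the support of `θ` into that of `ν`, so no perturbation is possible. Instead `N`
is restricted to a communicating class that carries the whole growth rate of `e^{(α-1)g}ν`; by
stationarity of `ν` such a class is closed and irreducible (`exists_minimizer_of_neg`). -/

/-! ### Growth of powers of nonnegative matrices -/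

section Growth

variable {d : ℕ}

/-- The sum of all entries of `M ^ n`. -/
noncomputable def powTotal (M : Matrix (Fin d) (Fin d) ℝ) (n : ℕ) : ℝ := ∑ i, ∑ j, (M ^ n) i j

theorem pow_entry_nonneg {ι : Type*} [Fintype ι] [DecidableEq ι] {M : Matrix ι ι ℝ}
    (hM : ∀ i j, 0 ≤ M i j) (n : ℕ) (i j : ι) : 0 ≤ (M ^ n) i j := by
  induction n generalizing i j with
  | zero => rw [pow_zero, Matrix.one_apply]; split_ifs <;> norm_num
  | succ n ih =>
    rw [pow_succ, Matrix.mul_apply]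
    exact Finset.sum_nonneg fun k _ => mul_nonneg (ih i k) (hM k j)

theorem powTotal_nonneg {M : Matrix (Fin d) (Fin d) ℝ} (hM : ∀ i j, 0 ≤ M i j) (n : ℕ) :
    0 ≤ powTotal M n :=
  Finset.sum_nonneg fun i _ => Finset.sum_nonneg fun j _ => pow_entry_nonneg hM n i j

theorem pow_entry_le_powTotal {M : Matrix (Fin d) (Fin d) ℝ} (hM : ∀ i j, 0 ≤ M i j) (n : ℕ)
    (i j : Fin d) : (M ^ n) i j ≤ powTotal M n :=
  (Finset.single_le_sum (f := fun j => (M ^ n) i j) (fun j _ => pow_entry_nonneg hM n i j)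
    (Finset.mem_univ j)).trans
  (Finset.single_le_sum (f := fun i => ∑ j, (M ^ n) i j)
    (fun i _ => Finset.sum_nonneg fun j _ => pow_entry_nonneg hM n i j) (Finset.mem_univ i))

theorem powTotal_add_le {M : Matrix (Fin d) (Fin d) ℝ} (hM : ∀ i j, 0 ≤ M i j) (m n : ℕ) :
    powTotal M (m + n) ≤ powTotal M m * powTotal M n := by
  have h1 : powTotal M (m + n) = ∑ k, (∑ i, (M ^ m) i k) * ∑ j, (M ^ n) k j := by
    unfold powTotal
    simp_rw [pow_add, Matrix.mul_apply, Finset.sum_mul_sum]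
    rw [Finset.sum_comm' (t' := Finset.univ) (s' := fun _ => Finset.univ) (by simp)]
    rw [Finset.sum_comm]
    conv_rhs => rw [Finset.sum_comm]
    refine Finset.sum_congr rfl fun i _ => ?_
    rw [Finset.sum_comm]
  have h2 : powTotal M m = ∑ k, ∑ i, (M ^ m) i k := Finset.sum_comm
  have h3 : ∀ k, 0 ≤ ∑ j, (M ^ n) k j :=
    fun k => Finset.sum_nonneg fun j _ => pow_entry_nonneg hM n k j
  rw [h1, h2, Finset.sum_mul]
  refine Finset.sum_le_sum fun k _ => mul_le_mul_of_nonneg_left ?_ ?_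
  · exact Finset.single_le_sum (f := fun k => ∑ j, (M ^ n) k j) (fun k _ => h3 k)
      (Finset.mem_univ k)
  · exact Finset.sum_nonneg fun i _ => pow_entry_nonneg hM m i k

theorem powTotal_eq_zero_of_le {M : Matrix (Fin d) (Fin d) ℝ} (hM : ∀ i j, 0 ≤ M i j) {m n : ℕ}
    (hmn : m ≤ n) (h : powTotal M m = 0) : powTotal M n = 0 := by
  refine le_antisymm ?_ (powTotal_nonneg hM n)
  obtain ⟨k, rfl⟩ := Nat.exists_eq_add_of_le hmn
  simpa [h] using powTotal_add_le hM m k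

/-- A nonzero entry of a power is bounded below by a power of the smallest nonzero entry. -/
theorem pow_entry_eq_zero_or_le {M : Matrix (Fin d) (Fin d) ℝ} (hM : ∀ i j, 0 ≤ M i j) {c : ℝ}
    (hc : 0 < c) (hcM : ∀ i j, M i j = 0 ∨ c ≤ M i j) (n : ℕ) (i j : Fin d) :
    (M ^ n) i j = 0 ∨ c ^ n ≤ (M ^ n) i j := by
  induction n generalizing i j with
  | zero => rw [pow_zero, Matrix.one_apply]; split_ifs <;> simp
  | succ n ih =>
    rw [pow_succ, Matrix.mul_apply]
    by_cases h : ∀ k, (M ^ n) i k * M k j = 0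
    · exact Or.inl (Finset.sum_eq_zero fun k _ => h k)
    · push Not at h
      obtain ⟨k, hk⟩ := h
      have h1 := (ih i k).resolve_left (left_ne_zero_of_mul hk)
      have h2 := (hcM k j).resolve_left (right_ne_zero_of_mul hk)
      right
      calc c ^ (n + 1) = c ^ n * c := pow_succ c n
        _ ≤ (M ^ n) i k * M k j := mul_le_mul h1 h2 hc.le (pow_entry_nonneg hM n i k)
        _ ≤ _ := Finset.single_le_sum (f := fun k => (M ^ n) i k * M k j)
            (fun k _ => mul_nonneg (pow_entry_nonneg hM n i k) (hM k j)) (Finset.mem_univ k)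

theorem exists_pos_le_of_ne_zero {ι : Type*} [Fintype ι] {f : ι → ℝ} (hf : ∀ i, 0 ≤ f i) :
    ∃ c : ℝ, 0 < c ∧ ∀ i, f i = 0 ∨ c ≤ f i := by
  classical
  have key : ∀ s : Finset ι, ∃ c : ℝ, 0 < c ∧ ∀ i ∈ s, f i = 0 ∨ c ≤ f i := by
    intro s
    induction s using Finset.induction_on with
    | empty => exact ⟨1, one_pos, by simp⟩
    | insert p s _ ih =>
      obtain ⟨c, hc, h⟩ := ih
      rcases (hf p).eq_or_lt with h0 | h0
      · refine ⟨c, hc, fun q hq => ?_⟩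
        rcases Finset.mem_insert.1 hq with rfl | hq
        · exact Or.inl h0.symm
        · exact h q hq
      · refine ⟨min c (f p), lt_min hc h0, fun q hq => ?_⟩
        rcases Finset.mem_insert.1 hq with rfl | hq
        · exact Or.inr (min_le_right _ _)
        · exact (h q hq).imp id (min_le_left _ _).trans
  obtain ⟨c, hc, h⟩ := key Finset.univ
  exact ⟨c, hc, fun i => h i (Finset.mem_univ i)⟩

/-! ### Existence of the growth rate -/

/-- No power of the nonnegative matrix `M` vanishes. -/
def NonVanishing (M : Matrix (Fin d) (Fin d) ℝ) : Prop := ∀ n, 0 < powTotal M n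

theorem subadditive_log_powTotal {M : Matrix (Fin d) (Fin d) ℝ} (hM : ∀ i j, 0 ≤ M i j)
    (h : NonVanishing M) : Subadditive fun n => Real.log (powTotal M n) := fun m n => by
  rw [← Real.log_mul (h m).ne' (h n).ne']
  exact Real.log_le_log (h _) (powTotal_add_le hM m n)

theorem bddBelow_log_powTotal {M : Matrix (Fin d) (Fin d) ℝ} (hM : ∀ i j, 0 ≤ M i j)
    (h : NonVanishing M) :
    BddBelow (Set.range fun n : ℕ => Real.log (powTotal M n) / n) := by
  obtain ⟨c, hc, hcM'⟩ := exists_pos_le_of_ne_zero (f := fun p : Fin d × Fin d => M p.1 p.2)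
    fun p => hM p.1 p.2
  have hcM : ∀ i j, M i j = 0 ∨ c ≤ M i j := fun i j => hcM' (i, j)
  -- At `n = 0` the quotient is `0` by the convention for division by zero, hence the minimum with
  -- `0`.
  refine ⟨min 0 (Real.log c), ?_⟩
  rintro _ ⟨n, rfl⟩
  rcases Nat.eq_zero_or_pos n with rfl | hn
  · simp
  refine (min_le_right _ _).trans ?_
  have hn' : (0 : ℝ) < n := Nat.cast_pos.2 hn
  have h1 : c ^ n ≤ powTotal M n := by
    by_contra hlt
    have : ∀ i j, (M ^ n) i j = 0 := fun i j =>
      (pow_entry_eq_zero_or_le hM hc hcM n i j).resolve_right fun hle =>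
        hlt (hle.trans (pow_entry_le_powTotal hM n i j))
    exact (h n).ne' (by simp [powTotal, this])
  show Real.log c ≤ Real.log (powTotal M n) / n
  rw [le_div_iff₀ hn', mul_comm, ← Real.log_pow]
  exact Real.log_le_log (pow_pos hc n) h1

/-- The real exponential growth rate of the powers of `M`. -/
noncomputable def growthExp (M : Matrix (Fin d) (Fin d) ℝ) : ℝ :=
  limUnder atTop fun n : ℕ => Real.log (powTotal M n) / n

theorem tendsto_growthExp {M : Matrix (Fin d) (Fin d) ℝ} (hM : ∀ i j, 0 ≤ M i j)
    (h : NonVanishing M) :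
    Tendsto (fun n : ℕ => Real.log (powTotal M n) / n) atTop (𝓝 (growthExp M)) :=
  tendsto_nhds_limUnder
    ⟨_, (subadditive_log_powTotal hM h).tendsto_lim (bddBelow_log_powTotal hM h)⟩

theorem growthExp_le {M : Matrix (Fin d) (Fin d) ℝ} (hM : ∀ i j, 0 ≤ M i j)
    (h : NonVanishing M) {n : ℕ} (hn : n ≠ 0) :
    growthExp M ≤ Real.log (powTotal M n) / n := by
  have := (subadditive_log_powTotal hM h).tendsto_lim (bddBelow_log_powTotal hM h)
  rw [tendsto_nhds_unique (tendsto_growthExp hM h) this]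
  exact (subadditive_log_powTotal hM h).lim_le_div (bddBelow_log_powTotal hM h) hn

theorem elog_of_pos {x : ℝ} (hx : 0 < x) : elog x = (Real.log x : ℝ) :=
  ENNReal.log_ofReal_of_pos hx

theorem elog_zero : elog 0 = ⊥ := by simp [elog]

theorem tendsto_growthSeq {M : Matrix (Fin d) (Fin d) ℝ} (hM : ∀ i j, 0 ≤ M i j)
    (h : NonVanishing M) : Tendsto (growthSeq M) atTop (𝓝 (growthExp M : EReal)) := by
  have : growthSeq M = fun n : ℕ => ((Real.log (powTotal M n) / n : ℝ) : EReal) := by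
    funext n
    rw [growthSeq, show (∑ i, ∑ j, (M ^ n) i j) = powTotal M n from rfl, elog_of_pos (h n),
      ← EReal.coe_mul]
    congr 1
    ring
  rw [this, EReal.tendsto_coe]
  exact tendsto_growthExp hM h

theorem tendsto_growthSeq_bot {M : Matrix (Fin d) (Fin d) ℝ} (hM : ∀ i j, 0 ≤ M i j)
    (h : ¬ NonVanishing M) : Tendsto (growthSeq M) atTop (𝓝 ⊥) := by
  obtain ⟨m, hm⟩ := not_forall.1 h
  have hm0 : powTotal M m = 0 := le_antisymm (not_lt.1 hm) (powTotal_nonneg hM m)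
  refine tendsto_const_nhds.congr' ?_
  filter_upwards [eventually_ge_atTop m, eventually_gt_atTop 0] with n hn hn0
  rw [growthSeq, show (∑ i, ∑ j, (M ^ n) i j) = powTotal M n from rfl,
    powTotal_eq_zero_of_le hM hn hm0, elog_zero, EReal.coe_mul_bot_of_pos (by positivity)]

theorem growthRate_eq {M : Matrix (Fin d) (Fin d) ℝ} (hM : ∀ i j, 0 ≤ M i j)
    (h : NonVanishing M) : growthRate M = (growthExp M : EReal) :=
  (tendsto_growthSeq hM h).limUnder_eq

/-- In a set where every state has a successor in the set, paths can be continued indefinitely. -/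
theorem nonVanishing_of_forall_exists {M : Matrix (Fin d) (Fin d) ℝ} (hM : ∀ i j, 0 ≤ M i j)
    {S : Set (Fin d)} (hS : S.Nonempty) (h : ∀ i ∈ S, ∃ j ∈ S, 0 < M i j) : NonVanishing M := by
  have key : ∀ n, ∀ i ∈ S, ∃ j, 0 < (M ^ n) i j := by
    intro n
    induction n with
    | zero => exact fun i _ => ⟨i, by simp⟩
    | succ n ih =>
      intro i hi
      obtain ⟨k, hk, hik⟩ := h i hi
      obtain ⟨j, hj⟩ := ih k hk
      refine ⟨j, ?_⟩
      rw [pow_succ', Matrix.mul_apply]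
      exact (mul_pos hik hj).trans_le (Finset.single_le_sum (f := fun k => M i k * (M ^ n) k j)
        (fun k _ => mul_nonneg (hM i k) (pow_entry_nonneg hM n k j)) (Finset.mem_univ k))
  obtain ⟨i, hi⟩ := hS
  intro n
  obtain ⟨j, hj⟩ := key n i hi
  exact hj.trans_le (pow_entry_le_powTotal hM n i j)

/-- Both limits exist, so a bound along infinitely many `n` suffices. The pigeonhole argument for
communicating classes provides only that much. -/
theorem growthExp_le_of_powTotal_le {A B : Matrix (Fin d) (Fin d) ℝ} (hA : ∀ i j, 0 ≤ A i j)
    (hB : ∀ i j, 0 ≤ B i j) (hA' : NonVanishing A) (hB' : NonVanishing B) {b c : ℝ} (hb : 0 < b)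
    (hc : 0 < c) (h : ∃ᶠ n in atTop, powTotal A n ≤ b * c ^ n * powTotal B n) :
    growthExp A ≤ growthExp B + Real.log c := by
  have h1 : Tendsto (fun n : ℕ => Real.log (powTotal A n) / n - Real.log (powTotal B n) / n
      - Real.log b / n) atTop (𝓝 (growthExp A - growthExp B - 0)) :=
    ((tendsto_growthExp hA hA').sub (tendsto_growthExp hB hB')).sub
      (tendsto_const_div_atTop_nhds_zero_nat _)
  have h2 := le_of_tendsto_of_frequently (b := Real.log c) h1
    ((h.and_eventually (eventually_gt_atTop 0)).mono fun n ⟨hn, hn0⟩ => by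
      have hn' : (0 : ℝ) < n := Nat.cast_pos.2 hn0
      have h3 := Real.log_le_log (hA' n) hn
      rw [Real.log_mul (by positivity) (hB' n).ne', Real.log_mul hb.ne' (by positivity),
        Real.log_pow] at h3
      rw [← sub_div, ← sub_div, div_le_iff₀ hn']
      linarith)
  linarith

/-- Comparison of growth rates up to a diagonal similarity. -/
theorem growthExp_le_of_similar {A B : Matrix (Fin d) (Fin d) ℝ} (hA : ∀ i j, 0 ≤ A i j)
    (hB : ∀ i j, 0 ≤ B i j) (hA' : NonVanishing A) (hB' : NonVanishing B) {w : Fin d → ℝ}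
    (hw : ∀ i, 0 < w i) {c : ℝ} (hc : 0 < c) (h : ∀ i j, A i j ≤ c * (B i j * (w j / w i))) :
    growthExp A ≤ growthExp B + Real.log c := by
  have key : ∀ n i j, (A ^ n) i j ≤ c ^ n * ((B ^ n) i j * (w j / w i)) := by
    intro n
    induction n with
    | zero =>
      intro i j
      simp only [pow_zero, Matrix.one_apply]
      split_ifs with hij
      · subst hij; simp [(hw i).ne']
      · simp
    | succ n ih =>
      intro i j
      rw [pow_succ A, pow_succ B, Matrix.mul_apply, Matrix.mul_apply, Finset.sum_mul,
        Finset.mul_sum]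
      refine Finset.sum_le_sum fun k _ => ?_
      have h0 : 0 ≤ c ^ n * ((B ^ n) i k * (w k / w i)) :=
        (pow_entry_nonneg hA n i k).trans (ih i k)
      refine (mul_le_mul (ih i k) (h k j) (hA k j) h0).trans (le_of_eq ?_)
      have := (hw k).ne'
      field_simp
      ring
  -- The diagonal factors telescope along a path, leaving one ratio `w j / w i`; `1 + W` bounds them
  -- all.
  set W := ∑ i, ∑ j, w j / w i
  have hW : ∀ i j, w j / w i ≤ 1 + W := fun i j => by
    have h1 : ∀ i j, 0 ≤ w j / w i := fun i j => (div_pos (hw j) (hw i)).le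
    have h2 := Finset.single_le_sum (f := fun j => w j / w i) (fun j _ => h1 i j)
      (Finset.mem_univ j)
    have h3 := Finset.single_le_sum (f := fun i => ∑ j, w j / w i)
      (fun i _ => Finset.sum_nonneg fun j _ => h1 i j) (Finset.mem_univ i)
    exact (h2.trans h3).trans (le_add_of_nonneg_left zero_le_one)
  have hW0 : 0 < 1 + W := by
    have : 0 ≤ W := Finset.sum_nonneg fun i _ => Finset.sum_nonneg fun j _ =>
      (div_pos (hw j) (hw i)).le
    linarith
  refine growthExp_le_of_powTotal_le hA hB hA' hB' hW0 hc (Frequently.of_forall fun n => ?_)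
  unfold powTotal
  rw [Finset.mul_sum]
  refine Finset.sum_le_sum fun i _ => ?_
  rw [Finset.mul_sum]
  refine Finset.sum_le_sum fun j _ => (key n i j).trans ?_
  have := mul_le_mul_of_nonneg_left (hW i j)
    (mul_nonneg (pow_pos hc n).le (pow_entry_nonneg hB n i j))
  linarith

theorem sum_rpow_mul_rpow_le {ι : Type*} (S : Finset ι) {a b : ι → ℝ} (ha : ∀ i, 0 ≤ a i)
    (hb : ∀ i, 0 ≤ b i) {s t : ℝ} (hs : 0 < s) (ht : 0 < t) (hst : s + t = 1) :
    ∑ i ∈ S, a i ^ s * b i ^ t ≤ (∑ i ∈ S, a i) ^ s * (∑ i ∈ S, b i) ^ t := by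
  have hpq : (1 / s).HolderConjugate (1 / t) := by
    rw [Real.holderConjugate_iff]
    refine ⟨by rw [lt_div_iff₀ hs]; linarith, by simpa using hst⟩
  have := Real.inner_le_Lp_mul_Lq_of_nonneg S hpq (f := fun i => a i ^ s) (g := fun i => b i ^ t)
    (fun i _ => Real.rpow_nonneg (ha i) _) (fun i _ => Real.rpow_nonneg (hb i) _)
  simpa [← Real.rpow_mul, ha, hb, mul_inv_cancel₀ hs.ne', mul_inv_cancel₀ ht.ne'] using this

/-- Log-convexity of the growth rate. -/
theorem growthExp_le_of_le_rpow_mul_rpow {A B C : Matrix (Fin d) (Fin d) ℝ}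
    (hA : ∀ i j, 0 ≤ A i j) (hB : ∀ i j, 0 ≤ B i j) (hC : ∀ i j, 0 ≤ C i j)
    (hA' : NonVanishing A) (hB' : NonVanishing B) (hC' : NonVanishing C) {s t : ℝ} (hs : 0 < s)
    (ht : 0 < t) (hst : s + t = 1) (h : ∀ i j, A i j ≤ B i j ^ s * C i j ^ t) :
    growthExp A ≤ s * growthExp B + t * growthExp C := by
  have key : ∀ n i j, (A ^ n) i j ≤ (B ^ n) i j ^ s * (C ^ n) i j ^ t := by
    intro n
    induction n with
    | zero =>
      intro i j
      simp only [pow_zero, Matrix.one_apply]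
      split_ifs with hij
      · simp
      · simp [hs.ne', ht.ne']
    | succ n ih =>
      intro i j
      rw [pow_succ A, pow_succ B, pow_succ C, Matrix.mul_apply, Matrix.mul_apply, Matrix.mul_apply]
      refine le_trans (Finset.sum_le_sum fun k _ => ?_) (sum_rpow_mul_rpow_le _
        (fun k => mul_nonneg (pow_entry_nonneg hB n i k) (hB k j))
        (fun k => mul_nonneg (pow_entry_nonneg hC n i k) (hC k j)) hs ht hst)
      refine (mul_le_mul (ih i k) (h k j) (hA k j) ((pow_entry_nonneg hA n i k).trans
        (ih i k))).trans (le_of_eq ?_)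
      rw [Real.mul_rpow (pow_entry_nonneg hB n i k) (hB k j),
        Real.mul_rpow (pow_entry_nonneg hC n i k) (hC k j)]
      ring
  have hT : ∀ n, powTotal A n ≤ powTotal B n ^ s * powTotal C n ^ t := by
    intro n
    unfold powTotal
    refine le_trans (Finset.sum_le_sum fun i _ => ?_) (sum_rpow_mul_rpow_le _
      (fun i => Finset.sum_nonneg fun j _ => pow_entry_nonneg hB n i j)
      (fun i => Finset.sum_nonneg fun j _ => pow_entry_nonneg hC n i j) hs ht hst)
    exact le_trans (Finset.sum_le_sum fun j _ => key n i j) (sum_rpow_mul_rpow_le _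
      (fun j => pow_entry_nonneg hB n i j) (fun j => pow_entry_nonneg hC n i j) hs ht hst)
  refine le_of_tendsto_of_tendsto' (tendsto_growthExp hA hA')
    (((tendsto_growthExp hB hB').const_mul s).add ((tendsto_growthExp hC hC').const_mul t))
    fun n => ?_
  have h1 := Real.log_le_log (hA' n) (hT n)
  rw [Real.log_mul (Real.rpow_pos_of_pos (hB' n) s).ne' (Real.rpow_pos_of_pos (hC' n) t).ne',
    Real.log_rpow (hB' n), Real.log_rpow (hC' n)] at h1
  refine (div_le_div_of_nonneg_right h1 (Nat.cast_nonneg n)).trans (le_of_eq ?_)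
  ring

/-- Upper semicontinuity of the growth rate along a ray. -/
theorem exists_growthExp_add_smul_le {M E : Matrix (Fin d) (Fin d) ℝ} (hM : ∀ i j, 0 ≤ M i j)
    (hE : ∀ i j, 0 ≤ E i j) (hM' : NonVanishing M) {δ : ℝ} (hδ : 0 < δ)
    (hME : ∀ ε : ℝ, 0 < ε → NonVanishing (M + ε • E)) :
    ∃ ε : ℝ, 0 < ε ∧ growthExp (M + ε • E) ≤ growthExp M + δ := by
  -- The growth rate is an infimum over `n` of functions continuous in `ε`. Fix one `n` that is
  -- nearly optimal at `ε = 0`, then use continuity for this `n` alone.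
  obtain ⟨n, hn, hn0⟩ := (((tendsto_growthExp hM hM').eventually_lt_const
    (lt_add_of_pos_right (growthExp M) hδ)).and (eventually_gt_atTop 0)).exists
  have hcont : Continuous fun ε : ℝ => powTotal (M + ε • E) n := by
    unfold powTotal
    refine continuous_finsetSum _ fun i _ => continuous_finsetSum _ fun j _ => ?_
    have : Continuous fun ε : ℝ => (M + ε • E) ^ n := by fun_prop
    exact this.matrix_elem i j
  have h1 : Tendsto (fun ε : ℝ => Real.log (powTotal (M + ε • E) n) / n) (𝓝[>] 0)
      (𝓝 (Real.log (powTotal M n) / n)) := by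
    have h2 : Tendsto (fun ε : ℝ => powTotal (M + ε • E) n) (𝓝[>] 0) (𝓝 (powTotal M n)) := by
      have := (hcont.tendsto 0).mono_left (nhdsWithin_le_nhds (s := Set.Ioi 0))
      simpa using this
    exact (h2.log (hM' n).ne').div_const _
  obtain ⟨ε, hε, hε0⟩ := ((h1.eventually_lt_const hn).and self_mem_nhdsWithin).exists
  have hε0' : 0 < ε := hε0
  refine ⟨ε, hε0', (growthExp_le (fun i j => ?_) (hME ε hε0') hn0.ne').trans hε.le⟩
  exact add_nonneg (hM i j) (mul_nonneg hε0'.le (hE i j))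

end Growth

/-! ### Positive eigenvectors and the associated Markov distributions -/

section Perron

theorem mulVec_pos {ι : Type*} [Fintype ι] {B : Matrix ι ι ℝ} (hB : ∀ i j, 0 < B i j)
    {y : ι → ℝ} (hy : ∀ i, 0 ≤ y i) (hy0 : y ≠ 0) (i : ι) : 0 < (B.mulVec y) i := by
  obtain ⟨j, hj⟩ := Function.ne_iff.1 hy0
  exact Finset.sum_pos' (fun k _ => mul_nonneg (hB i k).le (hy k))
    ⟨j, Finset.mem_univ j, mul_pos (hB i j) ((hy j).lt_of_ne' hj)⟩

/-- A nonnegative matrix that commutes with an entrywise positive one has an entrywise positive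
eigenvector. -/
theorem exists_pos_eigenvector {ι : Type*} [Fintype ι] [Nonempty ι]
    {A B : Matrix ι ι ℝ} (hA : ∀ i j, 0 ≤ A i j) (hB : ∀ i j, 0 < B i j) (hAB : A * B = B * A) :
    ∃ (w : ι → ℝ) (κ : ℝ), (∀ i, 0 < w i) ∧ 0 ≤ κ ∧ ∀ i, ∑ j, A i j * w j = κ * w i := by
  classical
  -- Summing `l x ≤ A x` over the simplex gives `l ≤ Λ`, which makes the feasible set compact.
  set Λ : ℝ := ∑ i, ∑ j, A i j
  set K : Set ((ι → ℝ) × ℝ) :=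
    (stdSimplex ℝ ι ×ˢ Set.Icc 0 Λ) ∩ {p | ∀ i, p.2 * p.1 i ≤ (A.mulVec p.1) i}
  have hK : IsCompact K := by
    refine ((isCompact_stdSimplex ℝ ι).prod isCompact_Icc).inter_right ?_
    rw [Set.ofPred_forall]
    refine isClosed_iInter fun i => isClosed_le (by fun_prop) ?_
    simp only [Matrix.mulVec, dotProduct]
    fun_prop
  have hmem : ∀ (x : ι → ℝ) (l : ℝ), (∀ i, 0 ≤ x i) → x ≠ 0 → 0 ≤ l →
      (∀ i, l * x i ≤ (A.mulVec x) i) → ∃ x', (x', l) ∈ K := by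
    intro x l hx hx0 hl h
    have hs : 0 < ∑ i, x i := by
      obtain ⟨j, hj⟩ := Function.ne_iff.1 hx0
      exact Finset.sum_pos' (fun k _ => hx k) ⟨j, Finset.mem_univ j, (hx j).lt_of_ne' hj⟩
    set s := ∑ i, x i
    have hx' : s⁻¹ • x ∈ stdSimplex ℝ ι := by
      refine ⟨fun i => mul_nonneg (inv_nonneg.2 hs.le) (hx i), ?_⟩
      simp only [Pi.smul_apply, smul_eq_mul, ← Finset.mul_sum]
      exact inv_mul_cancel₀ hs.ne'
    have hle : ∀ i, l * (s⁻¹ • x) i ≤ (A.mulVec (s⁻¹ • x)) i := by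
      intro i
      rw [Matrix.mulVec_smul]
      simp only [Pi.smul_apply, smul_eq_mul]
      have := mul_le_mul_of_nonneg_left (h i) (inv_nonneg.2 hs.le)
      linarith
    refine ⟨s⁻¹ • x, ⟨hx', hl, ?_⟩, hle⟩
    calc l = ∑ i, l * (s⁻¹ • x) i := by rw [← Finset.mul_sum, hx'.2, mul_one]
      _ ≤ ∑ i, (A.mulVec (s⁻¹ • x)) i := Finset.sum_le_sum fun i _ => hle i
      _ ≤ Λ := Finset.sum_le_sum fun i _ => Finset.sum_le_sum fun j _ =>
          mul_le_of_le_one_right (hA i j) (by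
            rw [← hx'.2]
            exact Finset.single_le_sum (fun k _ => hx'.1 k) (Finset.mem_univ j))
  have hne : K.Nonempty := by
    obtain ⟨x', h⟩ := hmem 1 0 (fun _ => zero_le_one) one_ne_zero le_rfl fun i => by
      rw [zero_mul]
      exact Finset.sum_nonneg fun j _ => mul_nonneg (hA i j) zero_le_one
    exact ⟨_, h⟩
  obtain ⟨⟨x, l⟩, hxl, hmax⟩ := hK.exists_isMaxOn hne continuous_snd.continuousOn
  obtain ⟨⟨hx, hl⟩, hle⟩ := hxl
  have hl0 : 0 ≤ l := hl.1
  have hxs : x ∈ stdSimplex ℝ ι := hx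
  have hx0 : x ≠ 0 := by
    rintro rfl
    simpa using hxs.2
  have hz := mulVec_pos hB hxs.1 hx0
  have hAx : A.mulVec x = l • x := by
    by_contra hne'
    set y := A.mulVec x - l • x
    have hy : ∀ i, 0 ≤ y i := fun i => sub_nonneg.2 (hle i)
    have hy0 : y ≠ 0 := sub_ne_zero.2 hne'
    have hBy := mulVec_pos hB hy hy0
    have hABx : A.mulVec (B.mulVec x) = l • B.mulVec x + B.mulVec y := by
      rw [Matrix.mulVec_mulVec, hAB, ← Matrix.mulVec_mulVec, Matrix.mulVec_sub,
        Matrix.mulVec_smul]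
      abel
    -- The smallest ratio of the slack `B y` to `B x` is an admissible increase of `l`.
    obtain ⟨i₀, -, hi₀⟩ := Finset.exists_min_image Finset.univ
      (fun i => (B.mulVec y) i / (B.mulVec x) i) Finset.univ_nonempty
    set η := (B.mulVec y) i₀ / (B.mulVec x) i₀
    have hη : 0 < η := div_pos (hBy i₀) (hz i₀)
    obtain ⟨x', hx'⟩ := hmem (B.mulVec x) (l + η) (fun i => (hz i).le)
      (fun h => (hz i₀).ne' (congrFun h i₀)) (by positivity) fun i => by
        have := (le_div_iff₀ (hz i)).1 (hi₀ i (Finset.mem_univ i))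
        rw [hABx]
        simp only [Pi.add_apply, Pi.smul_apply, smul_eq_mul]
        linarith
    have : l + η ≤ l := hmax hx'
    linarith
  refine ⟨B.mulVec x, l, hz, hl0, fun i => ?_⟩
  have : A.mulVec (B.mulVec x) = l • B.mulVec x := by
    rw [Matrix.mulVec_mulVec, hAB, ← Matrix.mulVec_mulVec, hAx, Matrix.mulVec_smul]
  exact congrFun this i

/-- Left and right positive eigenvectors to the same eigenvalue. -/
theorem exists_pos_eigenvectors {ι : Type*} [Fintype ι] [Nonempty ι]
    {A B : Matrix ι ι ℝ} (hA : ∀ i j, 0 ≤ A i j) (hA0 : A ≠ 0) (hB : ∀ i j, 0 < B i j)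
    (hAB : A * B = B * A) :
    ∃ (u w : ι → ℝ) (κ : ℝ), (∀ i, 0 < u i) ∧ (∀ i, 0 < w i) ∧ 0 < κ ∧
      (∀ j, ∑ i, u i * A i j = κ * u j) ∧ ∀ i, ∑ j, A i j * w j = κ * w i := by
  obtain ⟨w, κ, hw, hκ, hAw⟩ := exists_pos_eigenvector hA hB hAB
  obtain ⟨u, κ', hu, -, hAu⟩ := exists_pos_eigenvector (A := A.transpose) (B := B.transpose)
    (fun i j => hA j i) (fun i j => hB j i) (by
      rw [← Matrix.transpose_mul, ← Matrix.transpose_mul, hAB])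
  simp only [Matrix.transpose_apply] at hAu
  have huw : 0 < ∑ i, u i * w i :=
    Finset.sum_pos (fun i _ => mul_pos (hu i) (hw i)) Finset.univ_nonempty
  -- Evaluate the pairing of `u` with `A w` from both sides and divide by the positive `∑ i, u i * w
  -- i`.
  have heq : κ' = κ := by
    have h1 : ∑ i, u i * ∑ j, A i j * w j = κ * ∑ i, u i * w i := by
      rw [Finset.mul_sum]
      exact Finset.sum_congr rfl fun i _ => by rw [hAw]; ring
    have h2 : ∑ i, u i * ∑ j, A i j * w j = κ' * ∑ i, u i * w i := by
      rw [Finset.mul_sum]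
      simp_rw [Finset.mul_sum]
      rw [Finset.sum_comm]
      refine Finset.sum_congr rfl fun j _ => ?_
      rw [← mul_assoc, ← hAu, Finset.sum_mul]
      exact Finset.sum_congr rfl fun i _ => by ring
    exact mul_right_cancel₀ huw.ne' (h2.symm.trans h1)
  subst heq
  refine ⟨u, w, κ', hu, hw, hκ.lt_of_ne ?_, fun j => ?_, hAw⟩
  · intro h0
    apply hA0
    ext i j
    have h1 := hAw i
    rw [← h0, zero_mul] at h1
    have h2 := (Finset.sum_eq_zero_iff_of_nonneg fun k _ =>
      mul_nonneg (hA i k) (hw k).le).1 h1 j (Finset.mem_univ j)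
    exact (mul_eq_zero.1 h2).resolve_right (hw j).ne'
  · rw [← hAu]
    exact Finset.sum_congr rfl fun i _ => mul_comm _ _

/-! ### Markov distributions built from eigenvectors -/

variable {d : ℕ}

/-- The Markov distribution with transition probabilities `N i j * w j / (κ * w i)`, for a right
eigenvector `w` and a left eigenvector `u` of `N`. -/
noncomputable def eigenMarkov (N : Matrix (Fin d) (Fin d) ℝ) (u w : Fin d → ℝ) (κ : ℝ) :
    Matrix (Fin d) (Fin d) ℝ :=
  Matrix.of fun i j => u i * N i j * w j / (κ * ∑ k, u k * w k)

theorem sum_eigenMarkov {N : Matrix (Fin d) (Fin d) ℝ} {u w : Fin d → ℝ} {κ : ℝ}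
    (hκ : 0 < κ) (hr : ∀ i, u i ≠ 0 → ∑ j, N i j * w j = κ * w i) (i : Fin d) :
    ∑ j, eigenMarkov N u w κ i j = u i * w i / ∑ k, u k * w k := by
  simp only [eigenMarkov, Matrix.of_apply]
  rw [← Finset.sum_div]
  simp_rw [mul_assoc]
  rw [← Finset.mul_sum]
  by_cases hi : u i = 0
  · simp [hi]
  · rw [hr i hi, mul_left_comm, mul_div_mul_left _ _ hκ.ne']

/-- Both marginals equal `u k * w k` up to normalisation: the rows by the right eigenvector
equation, the columns by the left one. The right equation is needed only where `u` is nonzero, so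
that `w` may be extended arbitrarily off a communicating class. -/
theorem eigenMarkov_mem {N : Matrix (Fin d) (Fin d) ℝ} (hN : ∀ i j, 0 ≤ N i j) {u w : Fin d → ℝ}
    {κ : ℝ} (hκ : 0 < κ) (hu : ∀ i, 0 ≤ u i) (hw : ∀ i, 0 < w i) (hu0 : u ≠ 0)
    (hl : ∀ j, ∑ i, u i * N i j = κ * u j)
    (hr : ∀ i, u i ≠ 0 → ∑ j, N i j * w j = κ * w i) :
    eigenMarkov N u w κ ∈ MarkovDist d ∧ ∀ i j, condProb (eigenMarkov N u w κ) i j =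
      if u i = 0 then 0 else N i j * w j / (κ * w i) := by
  have hs : 0 < ∑ k, u k * w k := by
    obtain ⟨j, hj⟩ := Function.ne_iff.1 hu0
    exact Finset.sum_pos' (fun k _ => mul_nonneg (hu k) (hw k).le)
      ⟨j, Finset.mem_univ j, mul_pos ((hu j).lt_of_ne' hj) (hw j)⟩
  have hrow := sum_eigenMarkov hκ hr
  refine ⟨⟨fun i j => ?_, ?_, fun k => ?_⟩, fun i j => ?_⟩
  · exact div_nonneg (mul_nonneg (mul_nonneg (hu i) (hN i j)) (hw j).le) (by positivity)
  · simp_rw [hrow]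
    rw [← Finset.sum_div, div_self hs.ne']
  · rw [hrow]
    simp only [eigenMarkov, Matrix.of_apply]
    rw [← Finset.sum_div, ← Finset.sum_mul, hl, mul_assoc, mul_div_mul_left _ _ hκ.ne']
  · rw [condProb, hrow]
    by_cases hi : u i = 0
    · simp [hi]
    · have hi' : 0 < u i := (hu i).lt_of_ne' hi
      rw [if_pos (div_pos (mul_pos hi' (hw i)) hs), if_neg hi]
      simp only [eigenMarkov, Matrix.of_apply]
      have := (hw i).ne'
      field_simp

end Perron

/-! ### Markov distributions and the Rényi divergence rate -/

section Renyi

variable {d : ℕ}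

theorem condProb_nonneg {ν : Matrix (Fin d) (Fin d) ℝ} (hν : ν ∈ MarkovDist d) (i j : Fin d) :
    0 ≤ condProb ν i j := by
  unfold condProb
  split_ifs with h
  · exact div_nonneg (hν.1 i j) h.le
  · exact le_rfl

theorem row_pos_of_pos {ν : Matrix (Fin d) (Fin d) ℝ} (hν : ν ∈ MarkovDist d) {i j : Fin d}
    (h : 0 < ν i j) : 0 < ∑ k, ν i k :=
  Finset.sum_pos' (fun k _ => hν.1 i k) ⟨j, Finset.mem_univ j, h⟩

theorem row_pos_of_pos_right {ν : Matrix (Fin d) (Fin d) ℝ} (hν : ν ∈ MarkovDist d) {i j : Fin d}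
    (h : 0 < ν i j) : 0 < ∑ k, ν j k := by
  rw [hν.2.2 j]
  exact Finset.sum_pos' (fun k _ => hν.1 k j) ⟨i, Finset.mem_univ i, h⟩

theorem condProb_pos_iff {ν : Matrix (Fin d) (Fin d) ℝ} (hν : ν ∈ MarkovDist d) {i j : Fin d} :
    0 < condProb ν i j ↔ 0 < ν i j := by
  unfold condProb
  split_ifs with h
  · exact div_pos_iff_of_pos_right h
  · exact ⟨fun h' => absurd h' (lt_irrefl _), fun h' => absurd (row_pos_of_pos hν h') h⟩

theorem row_mul_condProb {ν : Matrix (Fin d) (Fin d) ℝ} (hν : ν ∈ MarkovDist d) (i j : Fin d) :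
    (∑ k, ν i k) * condProb ν i j = ν i j := by
  unfold condProb
  split_ifs with h
  · exact mul_div_cancel₀ _ h.ne'
  · rw [mul_zero]
    by_contra hne
    exact h (row_pos_of_pos hν ((hν.1 i j).lt_of_ne hne))

theorem exists_pos_of_row_pos {ν : Matrix (Fin d) (Fin d) ℝ} {i : Fin d}
    (h : 0 < ∑ k, ν i k) : ∃ j, 0 < ν i j := by
  by_contra! hne
  exact h.not_ge (Finset.sum_nonpos fun j _ => hne j)

theorem exists_row_pos {ν : Matrix (Fin d) (Fin d) ℝ} (hν : ν ∈ MarkovDist d) :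
    ∃ i, 0 < ∑ k, ν i k := by
  by_contra! hne
  have := Finset.sum_nonpos fun i (_ : i ∈ Finset.univ) => hne i
  rw [hν.2.1] at this
  linarith

theorem nonVanishing_of_markov {ν A : Matrix (Fin d) (Fin d) ℝ} (hν : ν ∈ MarkovDist d)
    (hA : ∀ i j, 0 ≤ A i j) (h : ∀ i j, 0 < ν i j → 0 < A i j) : NonVanishing A := by
  refine nonVanishing_of_forall_exists hA (S := {i | 0 < ∑ k, ν i k}) (exists_row_pos hν) ?_
  intro i hi
  obtain ⟨j, hj⟩ := exists_pos_of_row_pos hi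
  exact ⟨j, row_pos_of_pos_right hν hj, h i j hj⟩

theorem expTilt_nonneg (c : ℝ) (G : Matrix (Fin d) (Fin d) ℝ) {ν : Matrix (Fin d) (Fin d) ℝ}
    (hν : ν ∈ MarkovDist d) (i j : Fin d) : 0 ≤ expTilt c G ν i j :=
  mul_nonneg (Real.exp_pos _).le (condProb_nonneg hν i j)

theorem nonVanishing_expTilt (c : ℝ) (G : Matrix (Fin d) (Fin d) ℝ) {ν : Matrix (Fin d) (Fin d) ℝ}
    (hν : ν ∈ MarkovDist d) : NonVanishing (expTilt c G ν) :=
  nonVanishing_of_markov hν (expTilt_nonneg c G hν) fun _ _ h =>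
    mul_pos (Real.exp_pos _) ((condProb_pos_iff hν).2 h)

theorem growthRate_expTilt (c : ℝ) (G : Matrix (Fin d) (Fin d) ℝ) {ν : Matrix (Fin d) (Fin d) ℝ}
    (hν : ν ∈ MarkovDist d) : growthRate (expTilt c G ν) = (growthExp (expTilt c G ν) : EReal) :=
  growthRate_eq (expTilt_nonneg c G hν) (nonVanishing_expTilt c G hν)

/-! ### Path laws as products of transitions -/

theorem chainLaw_succ {ν : Matrix (Fin d) (Fin d) ℝ} (hν : ν ∈ MarkovDist d) (n : ℕ)
    (x : Fin (n + 1) → Fin d) : chainLaw ν (n + 1) x =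
      (∑ k, ν (x 0) k) * ∏ k : Fin n, condProb ν (x k.castSucc) (x k.succ) := by
  cases n with
  | zero => simp [chainLaw]
  | succ n =>
    rw [Fin.prod_univ_succ, ← mul_assoc, Fin.castSucc_zero, row_mul_condProb hν]
    rfl

theorem chainLaw_nonneg {ν : Matrix (Fin d) (Fin d) ℝ} (hν : ν ∈ MarkovDist d) (n : ℕ)
    (x : Fin n → Fin d) : 0 ≤ chainLaw ν n x := by
  cases n with
  | zero => exact zero_le_one
  | succ n =>
    rw [chainLaw_succ hν]
    exact mul_nonneg (Finset.sum_nonneg fun k _ => hν.1 _ k)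
      (Finset.prod_nonneg fun k _ => condProb_nonneg hν _ _)

theorem sum_paths (C : Matrix (Fin d) (Fin d) ℝ) (a : Fin d → ℝ) (n : ℕ) :
    ∑ x : Fin (n + 1) → Fin d, a (x 0) * ∏ k : Fin n, C (x k.castSucc) (x k.succ) =
      ∑ i, a i * ∑ j, (C ^ n) i j := by
  induction n generalizing a with
  | zero =>
    rw [← (Equiv.funUnique (Fin 1) (Fin d)).symm.sum_comp]
    simp [Matrix.one_apply]
  | succ n ih =>
    rw [← (Fin.consEquiv fun _ => Fin d).sum_comp, Fintype.sum_prod_type]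
    refine Finset.sum_congr rfl fun i _ => ?_
    have h1 := ih fun j => C i j
    simp only [Fin.consEquiv, Equiv.coe_fn_mk, Fin.cons_zero, Fin.prod_univ_succ, Fin.castSucc_zero,
      Fin.cons_succ, ← Fin.succ_castSucc]
    rw [← Finset.mul_sum, h1, pow_succ']
    simp_rw [Matrix.mul_apply, Finset.mul_sum]
    rw [Finset.sum_comm]

/-! ### The Rényi divergence rate as a growth rate -/

/-- The matrix `[ν(j|i)^α θ(j|i)^(1-α)]`. -/
noncomputable def renyiMat (α : ℝ) (ν θ : Matrix (Fin d) (Fin d) ℝ) : Matrix (Fin d) (Fin d) ℝ :=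
  Matrix.of fun i j => condProb ν i j ^ α * condProb θ i j ^ (1 - α)

theorem renyiMat_nonneg (α : ℝ) {ν θ : Matrix (Fin d) (Fin d) ℝ} (hν : ν ∈ MarkovDist d)
    (hθ : θ ∈ MarkovDist d) (i j : Fin d) : 0 ≤ renyiMat α ν θ i j :=
  mul_nonneg (Real.rpow_nonneg (condProb_nonneg hν i j) _)
    (Real.rpow_nonneg (condProb_nonneg hθ i j) _)

theorem renyiMat_symm (α : ℝ) (ν θ : Matrix (Fin d) (Fin d) ℝ) :
    renyiMat (1 - α) θ ν = renyiMat α ν θ := by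
  ext i j
  simp only [renyiMat, Matrix.of_apply, sub_sub_cancel]
  exact mul_comm _ _

/-- `Real.rpow` sends `0` to `0` for every nonzero exponent, negative ones included, so the terms
outside the filter vanish. -/
theorem sum_rpow_div_mul {X : Type*} [Fintype X] {α : ℝ} (hα0 : α ≠ 0) (hα1 : α ≠ 1) {p q : X → ℝ}
    (hp : ∀ x, 0 ≤ p x) (hq : ∀ x, 0 ≤ q x) :
    ∑ x with 0 < p x * q x, (p x / q x) ^ α * q x = ∑ x, p x ^ α * q x ^ (1 - α) := by
  rw [Finset.sum_filter]
  refine Finset.sum_congr rfl fun x _ => ?_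
  rcases (hp x).eq_or_lt with h | h
  · simp [← h, hα0]
  rcases (hq x).eq_or_lt with h' | h'
  · simp [← h', sub_ne_zero.2 hα1.symm]
  rw [if_pos (mul_pos h h'), Real.div_rpow h.le h'.le, Real.rpow_sub h', Real.rpow_one]
  ring

theorem renyiPos_eq {X : Type*} [Fintype X] {α : ℝ} (hα0 : α ≠ 0) (hα1 : α ≠ 1) {p q : X → ℝ}
    (hp : ∀ x, 0 ≤ p x) (hq : ∀ x, 0 ≤ q x) (h : 1 < α → ∀ x, q x = 0 → p x = 0) :
    renyiPos α p q = ((1 / (α * (α - 1)) : ℝ) : EReal) *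
      elog (∑ x, p x ^ α * q x ^ (1 - α)) := by
  rw [renyiPos, if_neg (fun h' => h'.2 (h h'.1)), ← sum_rpow_div_mul hα0 hα1 hp hq]

/-- Outside `[0, 1]` this is the definition for negative order; inside `(0, 1)` it is a symmetry of
the formula. -/
theorem renyiDiv_symm {X : Type*} [Fintype X] {α : ℝ} (hα0 : α ≠ 0) (hα1 : α ≠ 1) {p q : X → ℝ}
    (hp : ∀ x, 0 ≤ p x) (hq : ∀ x, 0 ≤ q x) : renyiDiv (1 - α) q p = renyiDiv α p q := by
  unfold renyiDiv
  rcases lt_or_gt_of_ne hα0 with h0 | h0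
  · rw [if_pos (by linarith), if_neg (by linarith)]
  rcases lt_or_gt_of_ne hα1 with h1 | h1
  · rw [if_pos (by linarith), if_pos h0, renyiPos_eq hα0 hα1 hp hq (by intro h; linarith),
      renyiPos_eq (by intro h; apply hα1; linarith) (by intro h; apply hα0; linarith) hq hp
        (by intro h; linarith)]
    congr 2
    · congr 1
      ring
    · exact Finset.sum_congr rfl fun x _ => by rw [sub_sub_cancel, mul_comm]
  · rw [if_neg (by linarith), if_pos h0, sub_sub_cancel]

theorem renyiSeq_symm {α : ℝ} (hα0 : α ≠ 0) (hα1 : α ≠ 1) {ν θ : Matrix (Fin d) (Fin d) ℝ}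
    (hν : ν ∈ MarkovDist d) (hθ : θ ∈ MarkovDist d) : renyiSeq (1 - α) θ ν = renyiSeq α ν θ := by
  funext n
  rw [renyiSeq, renyiSeq, renyiDiv_symm hα0 hα1 (chainLaw_nonneg hν n) (chainLaw_nonneg hθ n)]

theorem chainLaw_eq_zero {ν θ : Matrix (Fin d) (Fin d) ℝ} (hν : ν ∈ MarkovDist d)
    (hθ : θ ∈ MarkovDist d) (h : ∀ i j, 0 < ν i j → 0 < θ i j) (n : ℕ) (x : Fin n → Fin d)
    (hx : chainLaw θ n x = 0) : chainLaw ν n x = 0 := by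
  cases n with
  | zero => exact absurd hx one_ne_zero
  | succ n =>
    rw [chainLaw_succ hν]
    rw [chainLaw_succ hθ] at hx
    by_contra hne
    rcases mul_eq_zero.1 hx with hx | hx
    · obtain ⟨j, hj⟩ := exists_pos_of_row_pos
        ((Finset.sum_nonneg fun k _ => hν.1 (x 0) k).lt_of_ne' (left_ne_zero_of_mul hne))
      exact (row_pos_of_pos hθ (h _ j hj)).ne' hx
    · obtain ⟨k, -, hk⟩ := Finset.prod_eq_zero_iff.1 hx
      have h1 := Finset.prod_ne_zero_iff.1 (right_ne_zero_of_mul hne) k (Finset.mem_univ k)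
      have h2 := (condProb_pos_iff hν).1 ((condProb_nonneg hν _ _).lt_of_ne' h1)
      exact ((condProb_pos_iff hθ).2 (h _ _ h2)).ne' hk

theorem exists_path {ν : Matrix (Fin d) (Fin d) ℝ} (hν : ν ∈ MarkovDist d) (n : ℕ) {i : Fin d}
    (hi : 0 < ∑ k, ν i k) : ∃ x : Fin (n + 1) → Fin d, x 0 = i ∧
      0 < ∏ k : Fin n, condProb ν (x k.castSucc) (x k.succ) := by
  induction n generalizing i with
  | zero => exact ⟨fun _ => i, rfl, by simp⟩
  | succ n ih =>
    obtain ⟨j, hj⟩ := exists_pos_of_row_pos hi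
    obtain ⟨x, hx, hx'⟩ := ih (row_pos_of_pos_right hν hj)
    refine ⟨Fin.cons i x, rfl, ?_⟩
    rw [Fin.prod_univ_succ]
    simp only [Fin.castSucc_zero, Fin.cons_zero, Fin.cons_succ, ← Fin.succ_castSucc, hx]
    exact mul_pos ((condProb_pos_iff hν).2 hj) hx'

/-- A path that starts with a transition forbidden under `θ` and continues inside the support of `ν`
makes the divergence infinite for every length at least two. -/
theorem tendsto_renyiSeq_top {α : ℝ} (hα : 1 < α) {ν θ : Matrix (Fin d) (Fin d) ℝ}
    (hν : ν ∈ MarkovDist d) (hθ : θ ∈ MarkovDist d) (h : ¬ ∀ i j, 0 < ν i j → 0 < θ i j) :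
    Tendsto (renyiSeq α ν θ) atTop (𝓝 ⊤) := by
  push Not at h
  obtain ⟨i, j, hij, hij'⟩ := h
  have hθ0 : θ i j = 0 := le_antisymm hij' (hθ.1 i j)
  refine (tendsto_add_atTop_iff_nat 2).1 (tendsto_const_nhds.congr fun n => ?_)
  obtain ⟨x, hx, hx'⟩ := exists_path hν n (row_pos_of_pos_right hν hij)
  have hnot : ¬ ∀ y, chainLaw θ (n + 2) y = 0 → chainLaw ν (n + 2) y = 0 := by
    intro hall
    have h1 := hall (Fin.cons i x) (by
      show θ i (x 0) * _ = 0
      rw [hx, hθ0, zero_mul])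
    rw [chainLaw_succ hν, Fin.prod_univ_succ] at h1
    simp only [Fin.castSucc_zero, Fin.cons_zero, Fin.cons_succ, ← Fin.succ_castSucc, hx] at h1
    exact (mul_pos (row_pos_of_pos hν hij)
      (mul_pos ((condProb_pos_iff hν).2 hij) hx')).ne' h1
  rw [renyiSeq, renyiDiv, if_pos (by linarith), renyiPos, if_pos ⟨hα, hnot⟩,
    EReal.coe_mul_top_of_pos (by positivity)]

theorem sum_chainLaw_rpow (α : ℝ) {ν θ : Matrix (Fin d) (Fin d) ℝ} (hν : ν ∈ MarkovDist d)
    (hθ : θ ∈ MarkovDist d) (n : ℕ) :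
    ∑ x, chainLaw ν (n + 1) x ^ α * chainLaw θ (n + 1) x ^ (1 - α) =
      ∑ i, ((∑ k, ν i k) ^ α * (∑ k, θ i k) ^ (1 - α)) * ∑ j, (renyiMat α ν θ ^ n) i j := by
  rw [← sum_paths]
  refine Finset.sum_congr rfl fun x _ => ?_
  rw [chainLaw_succ hν, chainLaw_succ hθ,
    Real.mul_rpow (Finset.sum_nonneg fun k _ => hν.1 _ k)
      (Finset.prod_nonneg fun k _ => condProb_nonneg hν _ _),
    Real.mul_rpow (Finset.sum_nonneg fun k _ => hθ.1 _ k)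
      (Finset.prod_nonneg fun k _ => condProb_nonneg hθ _ _),
    ← Real.finsetProd_rpow _ _ (fun k _ => condProb_nonneg hν _ _),
    ← Real.finsetProd_rpow _ _ (fun k _ => condProb_nonneg hθ _ _), mul_mul_mul_comm,
    ← Finset.prod_mul_distrib]
  rfl

/-- Weights that vanish only at zero rows change the total of the powers by bounded factors. -/
theorem exists_weighted_bounds {C : Matrix (Fin d) (Fin d) ℝ} (hC : ∀ i j, 0 ≤ C i j)
    {a : Fin d → ℝ} (ha : ∀ i, 0 ≤ a i) (h : ∀ i, a i = 0 → ∀ j, C i j = 0) :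
    ∃ b B : ℝ, 0 < b ∧ 0 < B ∧ ∀ n, 0 < n →
      b * powTotal C n ≤ ∑ i, a i * ∑ j, (C ^ n) i j ∧
      ∑ i, a i * ∑ j, (C ^ n) i j ≤ B * powTotal C n := by
  obtain ⟨b, hb, hab⟩ := exists_pos_le_of_ne_zero ha
  have hsum : 0 ≤ ∑ i, a i := Finset.sum_nonneg fun i _ => ha i
  refine ⟨b, 1 + ∑ i, a i, hb, by linarith, fun n hn => ⟨?_, ?_⟩⟩
  · rw [powTotal, Finset.mul_sum]
    refine Finset.sum_le_sum fun i _ => ?_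
    rcases hab i with h0 | h0
    -- A zero row of `C` remains zero in every positive power, but not in `C ^ 0`; hence the
    -- condition `0 < n`.
    · obtain ⟨m, rfl⟩ := Nat.exists_eq_succ_of_ne_zero hn.ne'
      have : ∀ j, (C ^ m.succ) i j = 0 := fun j => by
        rw [Nat.succ_eq_add_one, pow_succ', Matrix.mul_apply]
        exact Finset.sum_eq_zero fun k _ => by rw [h i h0, zero_mul]
      simp [this]
    · exact mul_le_mul_of_nonneg_right h0
        (Finset.sum_nonneg fun j _ => pow_entry_nonneg hC n i j)
  · rw [powTotal, Finset.mul_sum]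
    refine Finset.sum_le_sum fun i _ => mul_le_mul_of_nonneg_right ?_
        (Finset.sum_nonneg fun j _ => pow_entry_nonneg hC n i j)
    have := Finset.single_le_sum (fun i _ => ha i) (Finset.mem_univ i)
    linarith

theorem exists_renyiSum_bounds {α : ℝ} (hα0 : α ≠ 0) (hα1 : α ≠ 1)
    {ν θ : Matrix (Fin d) (Fin d) ℝ} (hν : ν ∈ MarkovDist d) (hθ : θ ∈ MarkovDist d) :
    ∃ b B : ℝ, 0 < b ∧ 0 < B ∧ ∀ n, 0 < n →
      b * powTotal (renyiMat α ν θ) n ≤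
        ∑ x, chainLaw ν (n + 1) x ^ α * chainLaw θ (n + 1) x ^ (1 - α) ∧
      ∑ x, chainLaw ν (n + 1) x ^ α * chainLaw θ (n + 1) x ^ (1 - α) ≤
        B * powTotal (renyiMat α ν θ) n := by
  simp_rw [sum_chainLaw_rpow α hν hθ]
  have hrow : ∀ {μ : Matrix (Fin d) (Fin d) ℝ}, μ ∈ MarkovDist d → ∀ i, 0 ≤ ∑ k, μ i k :=
    fun hμ i => Finset.sum_nonneg fun k _ => hμ.1 i k
  refine exists_weighted_bounds (renyiMat_nonneg α hν hθ) (fun i => mul_nonneg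
    (Real.rpow_nonneg (hrow hν i) _) (Real.rpow_nonneg (hrow hθ i) _)) fun i hi j => ?_
  have h1 : 1 - α ≠ 0 := sub_ne_zero.2 hα1.symm
  simp only [renyiMat, Matrix.of_apply]
  rcases mul_eq_zero.1 hi with hi | hi
  · rw [Real.rpow_eq_zero (hrow hν i) hα0] at hi
    simp [condProb, hi, hα0]
  · rw [Real.rpow_eq_zero (hrow hθ i) h1] at hi
    simp [condProb, hi, h1]

theorem tendsto_renyiSeq_of_pos {α : ℝ} (hα0 : 0 < α) (hα1 : α ≠ 1)
    {ν θ : Matrix (Fin d) (Fin d) ℝ} (hν : ν ∈ MarkovDist d) (hθ : θ ∈ MarkovDist d)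
    (h : 1 < α → ∀ i j, 0 < ν i j → 0 < θ i j) (hC : NonVanishing (renyiMat α ν θ)) :
    Tendsto (renyiSeq α ν θ) atTop
      (𝓝 ((1 / (α * (α - 1)) * growthExp (renyiMat α ν θ) : ℝ) : EReal)) := by
  set C := renyiMat α ν θ
  obtain ⟨b, B, hb, hB, hbB⟩ := exists_renyiSum_bounds hα0.ne' hα1 hν hθ
  set T : ℕ → ℝ := fun n => ∑ x, chainLaw ν (n + 1) x ^ α * chainLaw θ (n + 1) x ^ (1 - α)
  have hT : ∀ n, 0 < n → 0 < T n := fun n hn =>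
    (mul_pos hb (hC n)).trans_le (hbB n hn).1
  -- A path of `n + 1` states has `n` transitions, so the power is `n` while the divisor is `n + 1`;
  -- the quotient of the two tends to one.
  have hlim : Tendsto (fun n : ℕ => Real.log (T n) / ((n : ℝ) + 1)) atTop (𝓝 (growthExp C)) := by
    have h1 : Tendsto (fun n : ℕ => (Real.log (T n) - Real.log (powTotal C n)) / ((n : ℝ) + 1))
        atTop (𝓝 0) := by
      refine tendsto_bdd_div_atTop_nhds_zero (b := Real.log b) (B := Real.log B) ?_ ?_
        (tendsto_natCast_atTop_atTop.atTop_add tendsto_const_nhds)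
      · filter_upwards [eventually_gt_atTop 0] with n hn
        have := Real.log_le_log (mul_pos hb (hC n)) (hbB n hn).1
        rw [Real.log_mul hb.ne' (hC n).ne'] at this
        simp only [T, C] at this ⊢
        linarith
      · filter_upwards [eventually_gt_atTop 0] with n hn
        have := Real.log_le_log (hT n hn) (hbB n hn).2
        rw [Real.log_mul hB.ne' (hC n).ne'] at this
        simp only [T, C] at this ⊢
        linarith
    have h2 := ((tendsto_growthExp (renyiMat_nonneg α hν hθ) hC).mul
      (tendsto_natCast_div_add_atTop (1 : ℝ))).add h1
    rw [mul_one, add_zero] at h2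
    refine h2.congr' ?_
    filter_upwards [eventually_gt_atTop 0] with n hn
    have hn' : (0 : ℝ) < n := Nat.cast_pos.2 hn
    field_simp
    ring
  refine (tendsto_add_atTop_iff_nat 1).1 ?_
  refine (EReal.tendsto_coe.2 (hlim.const_mul (1 / (α * (α - 1))))).congr' ?_
  filter_upwards [eventually_gt_atTop 0] with n hn
  rw [renyiSeq, renyiDiv, if_pos hα0, renyiPos_eq hα0.ne' hα1 (chainLaw_nonneg hν _)
    (chainLaw_nonneg hθ _) (fun h1 x => chainLaw_eq_zero hν hθ (h h1) _ x),
    show (∑ x, chainLaw ν (n + 1) x ^ α * chainLaw θ (n + 1) x ^ (1 - α)) = T n from rfl,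
    elog_of_pos (hT n hn), ← EReal.coe_mul, ← EReal.coe_mul]
  congr 1
  push_cast
  ring

theorem tendsto_renyiSeq_top_of_not_nonVanishing {α : ℝ} (hα0 : 0 < α) (hα1 : α < 1)
    {ν θ : Matrix (Fin d) (Fin d) ℝ} (hν : ν ∈ MarkovDist d) (hθ : θ ∈ MarkovDist d)
    (hC : ¬ NonVanishing (renyiMat α ν θ)) : Tendsto (renyiSeq α ν θ) atTop (𝓝 ⊤) := by
  obtain ⟨b, B, hb, hB, hbB⟩ := exists_renyiSum_bounds hα0.ne' hα1.ne hν hθ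
  obtain ⟨m, hm⟩ := not_forall.1 hC
  have hnn := renyiMat_nonneg α hν hθ
  have hm0 := le_antisymm (not_lt.1 hm) (powTotal_nonneg hnn m)
  refine (tendsto_add_atTop_iff_nat 1).1 (tendsto_const_nhds.congr' ?_)
  filter_upwards [eventually_gt_atTop 0, eventually_ge_atTop m] with n hn hmn
  have h0 : ∑ x, chainLaw ν (n + 1) x ^ α * chainLaw θ (n + 1) x ^ (1 - α) = 0 := by
    have h1 := hbB n hn
    rw [powTotal_eq_zero_of_le hnn hmn hm0, mul_zero, mul_zero] at h1
    exact le_antisymm h1.2 h1.1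
  rw [renyiSeq, renyiDiv, if_pos hα0, renyiPos_eq hα0.ne' hα1.ne (chainLaw_nonneg hν _)
    (chainLaw_nonneg hθ _) (fun h1 => absurd h1 hα1.not_gt), h0, elog_zero,
    EReal.coe_mul_bot_of_neg, EReal.coe_mul_top_of_pos (by positivity)]
  exact div_neg_of_pos_of_neg one_pos (mul_neg_of_pos_of_neg hα0 (by linarith))

theorem nonVanishing_renyiMat_left (α : ℝ) {ν θ : Matrix (Fin d) (Fin d) ℝ}
    (hν : ν ∈ MarkovDist d) (hθ : θ ∈ MarkovDist d) (h : ∀ i j, 0 < ν i j → 0 < θ i j) :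
    NonVanishing (renyiMat α ν θ) :=
  nonVanishing_of_markov hν (renyiMat_nonneg α hν hθ) fun i j hij => mul_pos
    (Real.rpow_pos_of_pos ((condProb_pos_iff hν).2 hij) _)
    (Real.rpow_pos_of_pos ((condProb_pos_iff hθ).2 (h i j hij)) _)

/-- For positive order, the Rényi divergence rate is either infinite or given by the growth rate
of `renyiMat`. -/
theorem tendsto_renyiSeq_cases {α : ℝ} (hα0 : 0 < α) (hα1 : α ≠ 1)
    {ν θ : Matrix (Fin d) (Fin d) ℝ} (hν : ν ∈ MarkovDist d) (hθ : θ ∈ MarkovDist d) :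
    Tendsto (renyiSeq α ν θ) atTop (𝓝 ⊤) ∨
      (1 < α → ∀ i j, 0 < ν i j → 0 < θ i j) ∧ NonVanishing (renyiMat α ν θ) ∧
        Tendsto (renyiSeq α ν θ) atTop
          (𝓝 ((1 / (α * (α - 1)) * growthExp (renyiMat α ν θ) : ℝ) : EReal)) := by
  by_cases h : 1 < α → ∀ i j, 0 < ν i j → 0 < θ i j
  · by_cases hC : NonVanishing (renyiMat α ν θ)
    · exact Or.inr ⟨h, hC, tendsto_renyiSeq_of_pos hα0 hα1 hν hθ h hC⟩
    · rcases lt_or_gt_of_ne hα1 with h1 | h1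
      · exact Or.inl (tendsto_renyiSeq_top_of_not_nonVanishing hα0 h1 hν hθ hC)
      · exact absurd (nonVanishing_renyiMat_left α hν hθ (h h1)) hC
  · obtain ⟨h1, h2⟩ := Classical.not_imp.1 h
    exact Or.inl (tendsto_renyiSeq_top h1 hν hθ h2)

end Renyi

/-! ### Communicating classes -/

section Classes

variable {d : ℕ}

/-- The states that can be reached from `i`. -/
def reachSet (ν : Matrix (Fin d) (Fin d) ℝ) (i : Fin d) : Set (Fin d) :=
  {j | Relation.ReflTransGen (fun a b => 0 < ν a b) i j}

/-- The restriction of a matrix to the rows in `C`. -/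
noncomputable def rowRestrict (C : Set (Fin d)) (M : Matrix (Fin d) (Fin d) ℝ) :
    Matrix (Fin d) (Fin d) ℝ :=
  open Classical in Matrix.of fun i j => if i ∈ C then M i j else 0

theorem mem_reachSet_of_pos {ν : Matrix (Fin d) (Fin d) ℝ} {i a b : Fin d}
    (ha : a ∈ reachSet ν i) (hab : 0 < ν a b) : b ∈ reachSet ν i :=
  Relation.ReflTransGen.tail ha hab

/-- By stationarity there is no flow into a closed set of states. -/
theorem mem_of_closed_of_pos {ν : Matrix (Fin d) (Fin d) ℝ} (hν : ν ∈ MarkovDist d)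
    {C : Set (Fin d)} (hC : ∀ a ∈ C, ∀ b, 0 < ν a b → b ∈ C) {a b : Fin d} (hb : b ∈ C)
    (hab : 0 < ν a b) : a ∈ C := by
  classical
  by_contra ha
  -- The mass leaving `S` equals the mass entering it. All of the former stays inside `S`, whereas
  -- the edge from `a` would add to the latter from outside.
  set S : Finset (Fin d) := Finset.univ.filter (· ∈ C)
  have h1 : ∑ x ∈ S, ∑ y, ν x y = ∑ x ∈ S, ∑ y ∈ S, ν x y := by
    refine Finset.sum_congr rfl fun x hx => (Finset.sum_subset (Finset.subset_univ S) ?_).symm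
    intro y _ hy
    by_contra hne
    exact hy (Finset.mem_filter.2 ⟨Finset.mem_univ y, hC x (Finset.mem_filter.1 hx).2 y
      ((hν.1 x y).lt_of_ne' hne)⟩)
  have h2 : ∑ x ∈ S, ∑ y, ν x y = ∑ x ∈ S, ∑ y, ν y x :=
    Finset.sum_congr rfl fun x _ => hν.2.2 x
  have h3 : ∑ x ∈ S, ∑ y ∈ S, ν x y = ∑ x ∈ S, ∑ y ∈ S, ν y x := Finset.sum_comm
  have h4 : ∑ x ∈ S, ∑ y ∈ S, ν y x < ∑ x ∈ S, ∑ y, ν y x := by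
    refine Finset.sum_lt_sum (fun x _ => Finset.sum_le_sum_of_subset_of_nonneg
      (Finset.subset_univ S) fun y _ _ => hν.1 y x)
      ⟨b, Finset.mem_filter.2 ⟨Finset.mem_univ b, hb⟩, ?_⟩
    exact Finset.sum_lt_sum_of_subset (Finset.subset_univ S) (Finset.mem_univ a)
      (fun h => ha (Finset.mem_filter.1 h).2) hab fun y _ _ => hν.1 y b
  linarith

/-- For an edge from `x` to `y`, the set reachable from `y` is closed and receives flow from `x`, so
it contains `x`: every edge can be undone by a path. -/
theorem reach_symm {ν : Matrix (Fin d) (Fin d) ℝ} (hν : ν ∈ MarkovDist d) {a b : Fin d}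
    (h : Relation.ReflTransGen (fun a b => 0 < ν a b) a b) :
    Relation.ReflTransGen (fun a b => 0 < ν a b) b a := by
  induction h with
  | refl => exact Relation.ReflTransGen.refl
  | @tail x y _ hxy ih =>
    exact Relation.ReflTransGen.trans (mem_of_closed_of_pos (C := reachSet ν y) hν
      (fun _ ha _ => mem_reachSet_of_pos ha) (b := y) Relation.ReflTransGen.refl hxy) ih

theorem reach_of_mem_reachSet {ν : Matrix (Fin d) (Fin d) ℝ} (hν : ν ∈ MarkovDist d)
    {i a b : Fin d} (ha : a ∈ reachSet ν i) (hb : b ∈ reachSet ν i) :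
    Relation.ReflTransGen (fun a b => 0 < ν a b) a b :=
  (reach_symm hν ha).trans hb

theorem row_pos_of_mem_reachSet {ν : Matrix (Fin d) (Fin d) ℝ} (hν : ν ∈ MarkovDist d)
    {i a : Fin d} (hi : 0 < ∑ k, ν i k) (ha : a ∈ reachSet ν i) : 0 < ∑ k, ν a k := by
  rcases Relation.ReflTransGen.cases_tail ha with h | ⟨c, -, hc⟩
  · rwa [← h] at hi
  · exact row_pos_of_pos_right hν hc

theorem pow_rowRestrict {ν M : Matrix (Fin d) (Fin d) ℝ} (hM : ∀ i j, M i j ≠ 0 → 0 < ν i j)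
    {C : Set (Fin d)} (hC : ∀ a ∈ C, ∀ b, 0 < ν a b → b ∈ C) (n : ℕ) {i : Fin d} (hi : i ∈ C)
    (j : Fin d) : (rowRestrict C M ^ n) i j = (M ^ n) i j := by
  induction n generalizing i with
  | zero => simp
  | succ n ih =>
    rw [pow_succ', pow_succ', Matrix.mul_apply, Matrix.mul_apply]
    refine Finset.sum_congr rfl fun k _ => ?_
    simp only [rowRestrict, Matrix.of_apply, if_pos hi]
    by_cases hk : M i k = 0
    · simp [hk]
    · congr 1
      exact ih (hC i hi k (hM i k hk))

theorem rowRestrict_nonneg {M : Matrix (Fin d) (Fin d) ℝ} (hM : ∀ i j, 0 ≤ M i j)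
    (C : Set (Fin d)) (i j : Fin d) : 0 ≤ rowRestrict C M i j := by
  simp only [rowRestrict, Matrix.of_apply]
  split_ifs
  · exact hM i j
  · exact le_rfl

theorem nonVanishing_rowRestrict {ν M : Matrix (Fin d) (Fin d) ℝ} (hν : ν ∈ MarkovDist d)
    (hM : ∀ i j, 0 ≤ M i j) (hMν : ∀ i j, 0 < ν i j → 0 < M i j) {i : Fin d}
    (hi : 0 < ∑ k, ν i k) : NonVanishing (rowRestrict (reachSet ν i) M) := by
  refine nonVanishing_of_forall_exists (rowRestrict_nonneg hM _) (S := reachSet ν i)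
    ⟨i, Relation.ReflTransGen.refl⟩ fun a ha => ?_
  obtain ⟨b, hb⟩ := exists_pos_of_row_pos (row_pos_of_mem_reachSet hν hi ha)
  refine ⟨b, mem_reachSet_of_pos ha hb, ?_⟩
  simp only [rowRestrict, Matrix.of_apply, if_pos ha]
  exact hMν a b hb

/-- Some communicating class carries the full growth rate. -/
theorem exists_growthExp_le_rowRestrict {ν M : Matrix (Fin d) (Fin d) ℝ} (hν : ν ∈ MarkovDist d)
    (hM : ∀ i j, 0 ≤ M i j) (hMν : ∀ i j, 0 < M i j ↔ 0 < ν i j) :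
    ∃ i, 0 < ∑ k, ν i k ∧ growthExp M ≤ growthExp (rowRestrict (reachSet ν i) M) := by
  have hNV : NonVanishing M := nonVanishing_of_markov hν hM fun i j => (hMν i j).2
  have hM0 : ∀ i j, M i j ≠ 0 → 0 < ν i j := fun i j h =>
    (hMν i j).1 ((hM i j).lt_of_ne' h)
  obtain ⟨i₀, -⟩ := exists_row_pos hν
  have hd : (0 : ℝ) < d := Nat.cast_pos.2 i₀.pos
  have h1 : ∀ n, 0 < n → ∃ i, 0 < ∑ k, ν i k ∧
      powTotal M n ≤ d * powTotal (rowRestrict (reachSet ν i) M) n := by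
    intro n hn
    -- Some row carries at least the fraction `1 / d` of the total. It depends on `n`, but one row
    -- must serve infinitely many `n`.
    obtain ⟨i, hi⟩ : ∃ i, powTotal M n ≤ d * ∑ j, (M ^ n) i j := by
      by_contra! hlt
      have h2 := Finset.sum_lt_sum_of_nonempty ⟨i₀, Finset.mem_univ i₀⟩
        fun i (_ : i ∈ Finset.univ) => hlt i
      rw [← Finset.mul_sum] at h2
      simp only [Finset.sum_const, Finset.card_univ, Fintype.card_fin, nsmul_eq_mul] at h2
      exact lt_irrefl _ h2
    have hpos : 0 < ∑ j, (M ^ n) i j := pos_of_mul_pos_right ((hNV n).trans_le hi) hd.le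
    have hrow : 0 < ∑ k, ν i k := by
      obtain ⟨j, hj⟩ : ∃ j, 0 < (M ^ n) i j := by
        by_contra! hne
        exact hpos.not_ge (Finset.sum_nonpos fun j _ => hne j)
      obtain ⟨m, rfl⟩ := Nat.exists_eq_succ_of_ne_zero hn.ne'
      rw [Nat.succ_eq_add_one, pow_succ', Matrix.mul_apply] at hj
      obtain ⟨k, -, hk⟩ := Finset.exists_ne_zero_of_sum_ne_zero hj.ne'
      exact row_pos_of_pos hν (hM0 i k (left_ne_zero_of_mul hk))
    refine ⟨i, hrow, hi.trans (mul_le_mul_of_nonneg_left ?_ hd.le)⟩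
    have h3 : ∑ j, (M ^ n) i j = ∑ j, (rowRestrict (reachSet ν i) M ^ n) i j :=
      Finset.sum_congr rfl fun j _ => (pow_rowRestrict hM0
        (fun _ ha _ => mem_reachSet_of_pos ha) n (i := i) Relation.ReflTransGen.refl j).symm
    rw [h3]
    exact Finset.single_le_sum (f := fun a => ∑ j, (rowRestrict (reachSet ν i) M ^ n) a j)
      (fun a _ => Finset.sum_nonneg fun j _ => pow_entry_nonneg (rowRestrict_nonneg hM _) n a j)
      (Finset.mem_univ i)
  have h2 : ∃ᶠ n in atTop, ∃ i, 0 < ∑ k, ν i k ∧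
      powTotal M n ≤ d * powTotal (rowRestrict (reachSet ν i) M) n :=
    ((eventually_gt_atTop 0).mono h1).frequently
  obtain ⟨i, hi⟩ := frequently_exists.1 h2
  have hrow : 0 < ∑ k, ν i k := hi.exists.choose_spec.1
  refine ⟨i, hrow, ?_⟩
  have := growthExp_le_of_powTotal_le hM (rowRestrict_nonneg hM _) hNV
    (nonVanishing_rowRestrict hν hM (fun i j => (hMν i j).2) hrow) hd one_pos
    (hi.mono fun n hn => by simpa using hn.2)
  simpa using this

/-- On the class the matrix is irreducible, so a sum of sufficiently many of its powers is entrywise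
positive and commutes with it; this is the `B` of `exists_pos_eigenvectors`. -/
theorem exists_eigenvectors_on_class {ν N : Matrix (Fin d) (Fin d) ℝ} (hν : ν ∈ MarkovDist d)
    (hN : ∀ i j, 0 ≤ N i j) (hNν : ∀ i j, 0 < N i j ↔ 0 < ν i j) {i₀ : Fin d}
    (hi₀ : 0 < ∑ k, ν i₀ k) :
    ∃ (u w : Fin d → ℝ) (κ : ℝ), (∀ i, 0 ≤ u i) ∧ (∀ i, u i ≠ 0 ↔ i ∈ reachSet ν i₀) ∧
      (∀ i, 0 < w i) ∧ 0 < κ ∧ (∀ j, ∑ i, u i * N i j = κ * u j) ∧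
      ∀ i, u i ≠ 0 → ∑ j, N i j * w j = κ * w i := by
  classical
  set C := reachSet ν i₀
  have hC : ∀ a ∈ C, ∀ b, 0 < ν a b → b ∈ C := fun _ ha _ => mem_reachSet_of_pos ha
  have hN0 : ∀ i ∈ C, ∀ j, j ∉ C → N i j = 0 := fun i hi j hj => by
    by_contra hne
    exact hj (hC i hi j ((hNν i j).1 ((hN i j).lt_of_ne' hne)))
  have h0C : i₀ ∈ C := Relation.ReflTransGen.refl
  have : Nonempty C := ⟨⟨i₀, h0C⟩⟩
  set A : Matrix C C ℝ := Matrix.of fun a b => N a b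
  have hA : ∀ a b, 0 ≤ A a b := fun a b => hN a b
  have hreach : ∀ a b : C, ∃ k, 0 < (A ^ k) a b := by
    intro a b
    have key : ∀ y, Relation.ReflTransGen (fun a b => 0 < ν a b) a.1 y →
        ∃ hy : y ∈ C, ∃ k, 0 < (A ^ k) a ⟨y, hy⟩ := by
      intro y hy
      induction hy with
      | refl => exact ⟨a.2, 0, by simp⟩
      | @tail x y _ hxy ih =>
        obtain ⟨hx, k, hk⟩ := ih
        refine ⟨hC x hx y hxy, k + 1, ?_⟩
        rw [pow_succ, Matrix.mul_apply]
        exact Finset.sum_pos' (fun c _ => mul_nonneg (pow_entry_nonneg hA k a c) (hA c _))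
          ⟨⟨x, hx⟩, Finset.mem_univ _, mul_pos hk ((hNν x y).2 hxy)⟩
    exact (key b (reach_of_mem_reachSet hν a.2 b.2)).2
  choose k hk using hreach
  set K := ∑ a, ∑ b, k a b
  have hkK : ∀ a b, k a b ≤ K := fun a b =>
    (Finset.single_le_sum (f := fun b => k a b) (fun _ _ => Nat.zero_le _)
      (Finset.mem_univ b)).trans
    (Finset.single_le_sum (f := fun a => ∑ b, k a b) (fun _ _ => Nat.zero_le _)
      (Finset.mem_univ a))
  have hB : ∀ a b, 0 < (∑ m ∈ Finset.range (K + 1), A ^ m) a b := fun a b => by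
    rw [Matrix.sum_apply]
    exact Finset.sum_pos' (fun m _ => pow_entry_nonneg hA m a b)
      ⟨k a b, Finset.mem_range.2 (Nat.lt_succ_of_le (hkK a b)), hk a b⟩
  have hAB : A * ∑ m ∈ Finset.range (K + 1), A ^ m = (∑ m ∈ Finset.range (K + 1), A ^ m) * A := by
    rw [Finset.mul_sum, Finset.sum_mul]
    exact Finset.sum_congr rfl fun m _ => (pow_mul_comm' A m).symm
  have hA0 : A ≠ 0 := by
    obtain ⟨j, hj⟩ := exists_pos_of_row_pos hi₀
    intro h
    have h1 : A ⟨i₀, h0C⟩ ⟨j, hC i₀ h0C j hj⟩ = 0 := by rw [h]; rfl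
    exact ((hNν i₀ j).2 hj).ne' h1
  obtain ⟨u, w, κ, hu, hw, hκ, hl, hr⟩ := exists_pos_eigenvectors hA hA0 hB hAB
  -- Extension by zero preserves the left equation everywhere because no edge leaves the class. The
  -- value `1` for `w'` only keeps it positive.
  set u' : Fin d → ℝ := fun i => if h : i ∈ C then u ⟨i, h⟩ else 0
  set w' : Fin d → ℝ := fun i => if h : i ∈ C then w ⟨i, h⟩ else 1
  have hu' : ∀ i, u' i ≠ 0 ↔ i ∈ C := fun i => by
    by_cases h : i ∈ C
    · simp [u', h, (hu ⟨i, h⟩).ne']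
    · simp [u', h]
  have hsum : ∀ f : Fin d → ℝ, (∀ i, i ∉ C → f i = 0) → ∑ i, f i = ∑ a : C, f a := by
    intro f hf
    rw [← Fintype.sum_subtype_add_sum_subtype (· ∈ C) f,
      Finset.sum_eq_zero (s := (Finset.univ : Finset {x // x ∉ C})) fun i _ => hf i i.2, add_zero]
  refine ⟨u', w', κ, fun i => ?_, hu', fun i => ?_, hκ, fun j => ?_, fun i hi => ?_⟩
  · by_cases h : i ∈ C
    · simp [u', h, (hu ⟨i, h⟩).le]
    · simp [u', h]
  · by_cases h : i ∈ C
    · simp [w', h, hw ⟨i, h⟩]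
    · simp [w', h]
  · rw [hsum _ fun i hi => by simp [u', hi]]
    by_cases hj : j ∈ C
    · simpa [u', hj, A] using hl ⟨j, hj⟩
    · simp only [u', dif_neg hj, mul_zero]
      exact Finset.sum_eq_zero fun a _ => by rw [hN0 a a.2 j hj, mul_zero]
  · have hiC := (hu' i).1 hi
    rw [hsum _ fun j hj => by rw [hN0 i hiC j hj, zero_mul]]
    simpa [w', hiC, A] using hr ⟨i, hiC⟩

end Classes

/-! ### The variational formulas -/

section Variational

variable {d : ℕ}

/-- The geometric-mean identity used for `α > 1`, where both exponents are positive;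
`rpow_mul_rpow_eq_expTilt` rearranges it for `0 < α < 1`. -/
theorem expTilt_eq_rpow_mul_rpow {α g p q : ℝ} (hα : 0 < α) (hp : 0 < p) (hq : 0 < q) :
    Real.exp ((α - 1) * g) * p =
      (Real.exp (α * g) * q) ^ ((α - 1) / α) * (p ^ α * q ^ (1 - α)) ^ (1 / α) := by
  obtain ⟨P, rfl⟩ : ∃ P, Real.exp P = p := ⟨_, Real.exp_log hp⟩
  obtain ⟨Q, rfl⟩ : ∃ Q, Real.exp Q = q := ⟨_, Real.exp_log hq⟩
  simp only [← Real.exp_mul, ← Real.exp_add]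
  congr 1
  field_simp
  ring

theorem rpow_mul_rpow_eq_expTilt {α g p q : ℝ} (hp : 0 < p) (hq : 0 < q) :
    p ^ α * q ^ (1 - α) =
      (Real.exp (α * g) * q) ^ (1 - α) * (Real.exp ((α - 1) * g) * p) ^ α := by
  obtain ⟨P, rfl⟩ : ∃ P, Real.exp P = p := ⟨_, Real.exp_log hp⟩
  obtain ⟨Q, rfl⟩ : ∃ Q, Real.exp Q = q := ⟨_, Real.exp_log hq⟩
  simp only [← Real.exp_mul, ← Real.exp_add]
  congr 1
  ring

/-- The Hölder inequality between growth rates, for positive order. -/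
theorem growthExp_expTilt_le {α : ℝ} (hα0 : 0 < α) (hα1 : α ≠ 1) (G : Matrix (Fin d) (Fin d) ℝ)
    {ν θ : Matrix (Fin d) (Fin d) ℝ} (hν : ν ∈ MarkovDist d) (hθ : θ ∈ MarkovDist d)
    (h : 1 < α → ∀ i j, 0 < ν i j → 0 < θ i j) (hC : NonVanishing (renyiMat α ν θ)) :
    1 / (α - 1) * growthExp (expTilt (α - 1) G ν) ≤ 1 / α * growthExp (expTilt α G θ) +
      1 / (α * (α - 1)) * growthExp (renyiMat α ν θ) := by
  have hA := expTilt_nonneg (α - 1) G hν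
  have hB := expTilt_nonneg α G hθ
  have hR := renyiMat_nonneg α hν hθ
  have hA' := nonVanishing_expTilt (α - 1) G hν
  have hB' := nonVanishing_expTilt α G hθ
  rcases lt_or_gt_of_ne hα1 with h1 | h1
  · have h2 := growthExp_le_of_le_rpow_mul_rpow hR hB hA hC hB' hA' (s := 1 - α) (t := α)
      (by linarith) hα0 (by ring) fun i j => by
        rcases (condProb_nonneg hν i j).eq_or_lt with hp | hp
        · simp [renyiMat, expTilt, ← hp, hα0.ne']
        rcases (condProb_nonneg hθ i j).eq_or_lt with hq | hq
        · simp [renyiMat, expTilt, ← hq, (sub_pos.2 h1).ne']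
        exact (rpow_mul_rpow_eq_expTilt hp hq).le
    have h3 : 0 < α * (1 - α) := mul_pos hα0 (by linarith)
    have h4 := div_le_div_of_nonneg_right h2 h3.le
    have h5 : 1 - α ≠ 0 := by linarith
    have e1 : 1 / (α * (α - 1)) * growthExp (renyiMat α ν θ) =
        -(growthExp (renyiMat α ν θ) / (α * (1 - α))) := by
      rw [show α * (α - 1) = -(α * (1 - α)) by ring]; field_simp
    have e2 : 1 / (α - 1) * growthExp (expTilt (α - 1) G ν) =
        -(growthExp (expTilt (α - 1) G ν) / (1 - α)) := by
      rw [show α - 1 = -(1 - α) by ring]; field_simp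
    rw [e1, e2]
    have e3 : ((1 - α) * growthExp (expTilt α G θ) + α * growthExp (expTilt (α - 1) G ν)) /
        (α * (1 - α)) = 1 / α * growthExp (expTilt α G θ) +
          growthExp (expTilt (α - 1) G ν) / (1 - α) := by
      field_simp
    linarith
  · have h1' : 0 < α - 1 := by linarith
    have h2 := growthExp_le_of_le_rpow_mul_rpow hA hB hR hA' hB' hC (s := (α - 1) / α)
      (t := 1 / α) (by positivity) (by positivity) (by field_simp; ring) fun i j => by
        rcases (condProb_nonneg hν i j).eq_or_lt with hp | hp
        · rw [show expTilt (α - 1) G ν i j = 0 by simp [expTilt, ← hp]]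
          exact mul_nonneg (Real.rpow_nonneg (hB i j) _) (Real.rpow_nonneg (hR i j) _)
        exact (expTilt_eq_rpow_mul_rpow hα0 hp ((condProb_pos_iff hθ).2
          (h h1 i j ((condProb_pos_iff hν).1 hp)))).le
    have h4 := mul_le_mul_of_nonneg_left h2 (one_div_pos.2 h1').le
    refine h4.trans (le_of_eq ?_)
    field_simp

theorem expTilt_neg (c : ℝ) (G ν : Matrix (Fin d) (Fin d) ℝ) :
    expTilt (-c) (-G) ν = expTilt c G ν := by
  ext i j
  simp [expTilt]

theorem expTilt_dual_left (α : ℝ) (G ν : Matrix (Fin d) (Fin d) ℝ) :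
    expTilt (1 - α) (-G) ν = expTilt (α - 1) G ν := by
  rw [← expTilt_neg (α - 1), neg_sub]

theorem expTilt_dual_right (α : ℝ) (G θ : Matrix (Fin d) (Fin d) ℝ) :
    expTilt (1 - α - 1) (-G) θ = expTilt α G θ := by
  rw [← expTilt_neg α]
  congr 1
  ring

theorem renyiRate_real_or_top {α : ℝ} (hα0 : α ≠ 0) (hα1 : α ≠ 1)
    (G : Matrix (Fin d) (Fin d) ℝ) {ν θ : Matrix (Fin d) (Fin d) ℝ} (hν : ν ∈ MarkovDist d)
    (hθ : θ ∈ MarkovDist d) :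
    Tendsto (renyiSeq α ν θ) atTop (𝓝 ⊤) ∨
      ∃ r : ℝ, Tendsto (renyiSeq α ν θ) atTop (𝓝 (r : EReal)) ∧
        1 / (α - 1) * growthExp (expTilt (α - 1) G ν) ≤
          1 / α * growthExp (expTilt α G θ) + r := by
  rcases lt_or_gt_of_ne hα0 with h0 | h0
  · have h1 : 1 - α ≠ 1 := by intro h; apply hα0; linarith
    have hsymm := renyiSeq_symm hα0 hα1 hν hθ
    rcases tendsto_renyiSeq_cases (α := 1 - α) (by linarith) h1 hθ hν with h | ⟨ha, hC, h⟩
    · exact Or.inl (hsymm ▸ h)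
    · refine Or.inr ⟨_, hsymm ▸ h, ?_⟩
      have := growthExp_expTilt_le (by linarith) h1 (-G) hθ hν ha hC
      rw [expTilt_dual_left, expTilt_dual_right] at this
      have e1 : 1 / (1 - α - 1) = -(1 / α) := by
        rw [show 1 - α - 1 = -α by ring, div_neg]
      have e2 : 1 / (1 - α) = -(1 / (α - 1)) := by
        rw [show 1 - α = -(α - 1) by ring, div_neg]
      rw [e1, e2] at this
      linarith
  · rcases tendsto_renyiSeq_cases h0 hα1 hν hθ with h | ⟨ha, hC, h⟩
    · exact Or.inl h
    · exact Or.inr ⟨_, h, growthExp_expTilt_le h0 hα1 G hν hθ ha hC⟩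

/-! ### Optimal and near-optimal distributions -/

theorem rpow_mul_eigen_rpow {α g c κ x y : ℝ} (hc : 0 < c) (hκ : 0 < κ) (hx : 0 < x) (hy : 0 < y) :
    c ^ α * (Real.exp (-1 * g) * c * y / (κ * x)) ^ (1 - α) =
      κ ^ (α - 1) * (Real.exp ((α - 1) * g) * c * (y ^ (1 - α) / x ^ (1 - α))) := by
  obtain ⟨C, rfl⟩ : ∃ P, Real.exp P = c := ⟨_, Real.exp_log hc⟩
  obtain ⟨K, rfl⟩ : ∃ P, Real.exp P = κ := ⟨_, Real.exp_log hκ⟩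
  obtain ⟨X, rfl⟩ : ∃ P, Real.exp P = x := ⟨_, Real.exp_log hx⟩
  obtain ⟨Y, rfl⟩ : ∃ P, Real.exp P = y := ⟨_, Real.exp_log hy⟩
  simp only [← Real.exp_mul, ← Real.exp_add, ← Real.exp_sub]
  congr 1
  ring

/-- The distribution `θ` comes from the eigenvectors of `e^{-g}ν + ε`. Its tilt by `e^{αg}` is
similar to a perturbation of `M` divided by `κ`. The bound on the divergence uses only that the
perturbation increases entries; the sign of `1 - α` decides how this compares `renyiMat` with `M`,
and the sign of the prefactor changes with it. -/
theorem exists_near_minimizer_of_pos {α : ℝ} (hα0 : 0 < α) (hα1 : α ≠ 1)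
    (G : Matrix (Fin d) (Fin d) ℝ) {ν : Matrix (Fin d) (Fin d) ℝ} (hν : ν ∈ MarkovDist d)
    {δ : ℝ} (hδ : 0 < δ) :
    ∃ θ ∈ MarkovDist d, ∃ r : ℝ, Tendsto (renyiSeq α ν θ) atTop (𝓝 (r : EReal)) ∧
      1 / α * growthExp (expTilt α G θ) + r ≤
        1 / (α - 1) * growthExp (expTilt (α - 1) G ν) + δ := by
  obtain ⟨i₀, -⟩ := exists_row_pos hν
  have : Nonempty (Fin d) := ⟨i₀⟩
  set M := expTilt (α - 1) G ν
  have hM : ∀ i j, 0 ≤ M i j := expTilt_nonneg (α - 1) G hν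
  have hM' : NonVanishing M := nonVanishing_expTilt (α - 1) G hν
  -- Chosen so that multiplying `e^{-g}ν + ε` entrywise by `e^{αg}` gives exactly `M + ε • E`.
  set E : Matrix (Fin d) (Fin d) ℝ := Matrix.of fun i j => Real.exp (α * G i j)
  have hE : ∀ i j, 0 < E i j := fun i j => Real.exp_pos _
  have hMEpos : ∀ ε : ℝ, 0 < ε → ∀ i j, 0 < (M + ε • E) i j := fun ε hε i j =>
    add_pos_of_nonneg_of_pos (hM i j) (mul_pos hε (hE i j))
  have hME : ∀ ε : ℝ, 0 < ε → NonVanishing (M + ε • E) := fun ε hε =>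
    nonVanishing_of_markov hν (fun i j => (hMEpos ε hε i j).le) fun i j _ => hMEpos ε hε i j
  obtain ⟨ε, hε, hgε⟩ := exists_growthExp_add_smul_le hM (fun i j => (hE i j).le) hM'
    (mul_pos hα0 hδ) hME
  set N : Matrix (Fin d) (Fin d) ℝ :=
    Matrix.of fun i j => Real.exp (-1 * G i j) * condProb ν i j + ε
  have hN : ∀ i j, 0 < N i j := fun i j =>
    add_pos_of_nonneg_of_pos (mul_nonneg (Real.exp_pos _).le (condProb_nonneg hν i j)) hε
  obtain ⟨u, w, κ, hu, hw, hκ, hl, hr⟩ := exists_pos_eigenvectors (fun i j => (hN i j).le)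
    (fun h => (hN i₀ i₀).ne' (by rw [h]; rfl)) hN rfl
  obtain ⟨hθ, hcθ⟩ := eigenMarkov_mem (fun i j => (hN i j).le) hκ (fun i => (hu i).le) hw
    (fun h => (hu i₀).ne' (congrFun h i₀)) hl fun i _ => hr i
  set θ := eigenMarkov N u w κ
  simp only [(hu _).ne', if_false] at hcθ
  have hθpos : ∀ i j, 0 < θ i j := fun i j => by
    rw [← condProb_pos_iff hθ, hcθ]
    exact div_pos (mul_pos (hN i j) (hw j)) (mul_pos hκ (hw i))
  have hC := nonVanishing_renyiMat_left α hν hθ fun i j _ => hθpos i j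
  have hCnn := renyiMat_nonneg α hν hθ
  refine ⟨θ, hθ, _, tendsto_renyiSeq_of_pos hα0 hα1 hν hθ (fun _ i j _ => hθpos i j) hC, ?_⟩
  have hT : growthExp (expTilt α G θ) ≤ growthExp (M + ε • E) + Real.log (1 / κ) := by
    refine growthExp_le_of_similar (expTilt_nonneg α G hθ) (fun i j => (hMEpos ε hε i j).le)
      (nonVanishing_expTilt α G hθ) (hME ε hε) hw (by positivity) fun i j => le_of_eq ?_
    have h1 : Real.exp ((α - 1) * G i j) = Real.exp (α * G i j) * Real.exp (-1 * G i j) := by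
      rw [← Real.exp_add]
      congr 1
      ring
    have := (hw i).ne'
    simp only [expTilt, Matrix.of_apply, hcθ, Matrix.add_apply, Matrix.smul_apply, smul_eq_mul, M,
      E, N, h1]
    field_simp
  rw [one_div κ, Real.log_inv] at hT
  have hR : 1 / (α * (α - 1)) * growthExp (renyiMat α ν θ) ≤
      1 / (α * (α - 1)) * (growthExp M + (α - 1) * Real.log κ) := by
    rcases lt_or_gt_of_ne hα1 with h1 | h1
    · refine mul_le_mul_of_nonpos_left ?_
        (div_neg_of_pos_of_neg one_pos (mul_neg_of_pos_of_neg hα0 (by linarith))).le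
      have h2 : growthExp M ≤ growthExp (renyiMat α ν θ) + Real.log (κ ^ (1 - α)) := by
        -- For `α < 1` the matrix `M` is the one to be bounded above, so the weights are the
        -- inverses of those in the case `α > 1`.
        refine growthExp_le_of_similar hM hCnn hM' hC (w := fun i => w i ^ (α - 1))
          (fun i => Real.rpow_pos_of_pos (hw i) _) (Real.rpow_pos_of_pos hκ _) fun i j => ?_
        have hwj := Real.rpow_pos_of_pos (hw j) (1 - α)
        have hwi := Real.rpow_pos_of_pos (hw i) (1 - α)
        have hκα := Real.rpow_pos_of_pos hκ (1 - α)
        rcases (condProb_nonneg hν i j).eq_or_lt with hp | hp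
        · rw [show M i j = 0 by simp [M, expTilt, ← hp]]
          exact mul_nonneg hκα.le (mul_nonneg (hCnn i j) (div_pos
            (Real.rpow_pos_of_pos (hw j) _) (Real.rpow_pos_of_pos (hw i) _)).le)
        have h3 : κ ^ (α - 1) * (M i j * (w j ^ (1 - α) / w i ^ (1 - α))) ≤
            renyiMat α ν θ i j := by
          refine (rpow_mul_eigen_rpow (g := G i j) hp hκ (hw i) (hw j)).symm.le.trans ?_
          simp only [renyiMat, Matrix.of_apply, hcθ]
          refine mul_le_mul_of_nonneg_left (Real.rpow_le_rpow ?_ ?_ (by linarith))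
            (Real.rpow_nonneg hp.le _)
          · have := hw i
            have := hw j
            positivity
          · have := hw i
            have := hw j
            simp only [N, Matrix.of_apply]
            gcongr
            linarith
        have e : ∀ x : ℝ, 0 < x → x ^ (α - 1) = (x ^ (1 - α))⁻¹ := fun x hx => by
          rw [← Real.rpow_neg hx.le, neg_sub]
        rw [e κ hκ] at h3
        rw [e _ (hw j), e _ (hw i)]
        calc M i j = κ ^ (1 - α) * ((κ ^ (1 - α))⁻¹ * (M i j * (w j ^ (1 - α) / w i ^ (1 - α))) *
              ((w j ^ (1 - α))⁻¹ / (w i ^ (1 - α))⁻¹)) := by field_simp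
          _ ≤ _ := by gcongr
      rw [Real.log_rpow hκ] at h2
      linarith
    · have h1' : 0 < α - 1 := by linarith
      refine mul_le_mul_of_nonneg_left ?_ (by positivity)
      rw [← Real.log_rpow hκ]
      refine growthExp_le_of_similar hCnn hM hC hM' (w := fun i => w i ^ (1 - α))
        (fun i => Real.rpow_pos_of_pos (hw i) _) (Real.rpow_pos_of_pos hκ _) fun i j => ?_
      rcases (condProb_nonneg hν i j).eq_or_lt with hp | hp
      · simp [renyiMat, M, expTilt, ← hp, hα0.ne']
      refine le_trans ?_ (rpow_mul_eigen_rpow (g := G i j) hp hκ (hw i) (hw j)).le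
      simp only [renyiMat, Matrix.of_apply, hcθ]
      have := hw i
      have := hw j
      refine mul_le_mul_of_nonneg_left (Real.rpow_le_rpow_of_nonpos (by positivity) ?_
        (by linarith)) (Real.rpow_nonneg hp.le _)
      simp only [N, Matrix.of_apply]
      gcongr
      linarith
  have h3 := mul_le_mul_of_nonneg_left (hT.trans (add_le_add_left hgε _)) (one_div_pos.2 hα0).le
  have h4 : α - 1 ≠ 0 := sub_ne_zero.2 hα1
  refine (add_le_add h3 hR).trans (le_of_eq ?_)
  field_simp
  ring

/-- Since `1 / α` is negative, a lower bound for the growth of `e^{αg}θ` is needed, and the class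
carrying the growth of `M` supplies it. Without a perturbation there is no error term. -/
theorem exists_minimizer_of_neg {α : ℝ} (hα0 : α < 0) (G : Matrix (Fin d) (Fin d) ℝ)
    {ν : Matrix (Fin d) (Fin d) ℝ} (hν : ν ∈ MarkovDist d) :
    ∃ θ ∈ MarkovDist d, ∃ r : ℝ, Tendsto (renyiSeq α ν θ) atTop (𝓝 (r : EReal)) ∧
      1 / α * growthExp (expTilt α G θ) + r ≤
        1 / (α - 1) * growthExp (expTilt (α - 1) G ν) := by
  have hα1 : α ≠ 1 := by linarith
  have htilt : ∀ c i j, 0 < expTilt c G ν i j ↔ 0 < ν i j := fun c i j => by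
    rw [← condProb_pos_iff hν]
    exact mul_pos_iff_of_pos_left (Real.exp_pos _)
  set M := expTilt (α - 1) G ν
  have hM : ∀ i j, 0 ≤ M i j := expTilt_nonneg (α - 1) G hν
  have hM' : NonVanishing M := nonVanishing_expTilt (α - 1) G hν
  obtain ⟨i₀, hi₀, hgM⟩ := exists_growthExp_le_rowRestrict hν hM (htilt (α - 1))
  have hN := expTilt_nonneg (-1) G hν
  obtain ⟨u, w, κ, hu, huC, hw, hκ, hl, hr⟩ :=
    exists_eigenvectors_on_class hν hN (htilt (-1)) hi₀
  have hMC' : NonVanishing (rowRestrict (reachSet ν i₀) M) :=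
    nonVanishing_rowRestrict hν hM (fun i j => (htilt (α - 1) i j).2) hi₀
  set C := reachSet ν i₀
  obtain ⟨hθ, hcθ⟩ := eigenMarkov_mem hN hκ hu hw
    (fun h => (huC i₀).2 Relation.ReflTransGen.refl (congrFun h i₀)) hl hr
  set θ := eigenMarkov (expTilt (-1) G ν) u w κ
  -- The order `1 - α` of the interchanged divergence exceeds one, so finiteness requires this
  -- inclusion of supports.
  have hθν : ∀ i j, 0 < θ i j → 0 < ν i j := fun i j hij => by
    rw [← condProb_pos_iff hθ, hcθ] at hij
    split_ifs at hij
    · exact absurd hij (lt_irrefl _)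
    · refine (htilt (-1) i j).1 ((hN i j).lt_of_ne' fun h => ?_)
      simp [h] at hij
  have hR' : NonVanishing (renyiMat α ν θ) :=
    renyiMat_symm α ν θ ▸ nonVanishing_renyiMat_left (1 - α) hθ hν hθν
  have hRnn := renyiMat_nonneg α hν hθ
  have hlim := tendsto_renyiSeq_of_pos (α := 1 - α) (by linarith) (by linarith) hθ hν
    (fun _ => hθν) (renyiMat_symm α ν θ ▸ hR')
  rw [renyiSeq_symm hα0.ne hα1 hν hθ, renyiMat_symm,
    show (1 - α) * (1 - α - 1) = α * (α - 1) by ring] at hlim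
  refine ⟨θ, hθ, _, hlim, ?_⟩
  have hT : growthExp M ≤ growthExp (expTilt α G θ) + Real.log κ := by
    refine hgM.trans (growthExp_le_of_similar (rowRestrict_nonneg hM _) (expTilt_nonneg α G hθ)
      hMC' (nonVanishing_expTilt α G hθ) (w := fun i => (w i)⁻¹) (fun i => inv_pos.2 (hw i)) hκ
      fun i j => ?_)
    simp only [rowRestrict, expTilt, Matrix.of_apply, hcθ]
    by_cases hi : u i = 0
    · have hiC : i ∉ C := fun h => (huC i).2 h hi
      simp [hi, hiC]
    · rw [if_pos ((huC i).1 hi), if_neg hi]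
      simp only [M, expTilt, Matrix.of_apply]
      have h1 : Real.exp ((α - 1) * G i j) = Real.exp (α * G i j) * Real.exp (-1 * G i j) := by
        rw [← Real.exp_add]
        congr 1
        ring
      have := (hw i).ne'
      have := (hw j).ne'
      rw [h1]
      field_simp
      exact le_rfl
  have hR : growthExp (renyiMat α ν θ) ≤ growthExp M + (α - 1) * Real.log κ := by
    rw [← Real.log_rpow hκ]
    refine growthExp_le_of_similar hRnn hM hR' hM' (w := fun i => w i ^ (1 - α))
      (fun i => Real.rpow_pos_of_pos (hw i) _) (Real.rpow_pos_of_pos hκ _) fun i j => ?_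
    have hnn : 0 ≤ κ ^ (α - 1) * (M i j * (w j ^ (1 - α) / w i ^ (1 - α))) :=
      mul_nonneg (Real.rpow_nonneg hκ.le _) (mul_nonneg (hM i j)
        (div_nonneg (Real.rpow_nonneg (hw j).le _) (Real.rpow_nonneg (hw i).le _)))
    rcases (condProb_nonneg hν i j).eq_or_lt with hp | hp
    · rw [show renyiMat α ν θ i j = 0 by simp [renyiMat, ← hp, hα0.ne]]
      exact hnn
    by_cases hi : u i = 0
    · rw [show renyiMat α ν θ i j = 0 by simp [renyiMat, hcθ, hi, sub_ne_zero.2 hα1.symm]]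
      exact hnn
    refine le_trans (le_of_eq ?_) (rpow_mul_eigen_rpow (g := G i j) hp hκ (hw i) (hw j)).le
    simp only [renyiMat, Matrix.of_apply, hcθ, if_neg hi, expTilt]
  have h3 := mul_le_mul_of_nonpos_left hT (one_div_neg.2 hα0).le
  have h4 := mul_le_mul_of_nonneg_left hR
    (one_div_pos.2 (mul_pos_of_neg_of_neg hα0 (by linarith : α - 1 < 0))).le
  have h5 : α - 1 ≠ 0 := sub_ne_zero.2 hα1
  have h6 : 1 / (α * (α - 1)) * (growthExp M + (α - 1) * Real.log κ) =
      1 / (α - 1) * growthExp M - 1 / α * growthExp M + 1 / α * Real.log κ := by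
    have := hα0.ne
    field_simp
    ring
  linarith

theorem exists_near_minimizer {α : ℝ} (hα0 : α ≠ 0) (hα1 : α ≠ 1)
    (G : Matrix (Fin d) (Fin d) ℝ) {ν : Matrix (Fin d) (Fin d) ℝ} (hν : ν ∈ MarkovDist d)
    {δ : ℝ} (hδ : 0 < δ) :
    ∃ θ ∈ MarkovDist d, ∃ r : ℝ, Tendsto (renyiSeq α ν θ) atTop (𝓝 (r : EReal)) ∧
      1 / α * growthExp (expTilt α G θ) + r ≤
        1 / (α - 1) * growthExp (expTilt (α - 1) G ν) + δ := by
  rcases lt_or_gt_of_ne hα0 with h | h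
  · obtain ⟨θ, hθ, r, hr, hle⟩ := exists_minimizer_of_neg h G hν
    exact ⟨θ, hθ, r, hr, by linarith⟩
  · exact exists_near_minimizer_of_pos h hα1 G hν hδ

/-- The near-minimizer for `(1 - α, -G, θ)`: the duality exchanges the two tilts and reverses the
signs of their prefactors. -/
theorem exists_near_maximizer {α : ℝ} (hα0 : α ≠ 0) (hα1 : α ≠ 1)
    (G : Matrix (Fin d) (Fin d) ℝ) {θ : Matrix (Fin d) (Fin d) ℝ} (hθ : θ ∈ MarkovDist d)
    {δ : ℝ} (hδ : 0 < δ) :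
    ∃ ν ∈ MarkovDist d, ∃ r : ℝ, Tendsto (renyiSeq α ν θ) atTop (𝓝 (r : EReal)) ∧
      1 / α * growthExp (expTilt α G θ) - δ ≤
        1 / (α - 1) * growthExp (expTilt (α - 1) G ν) - r := by
  obtain ⟨ν, hν, r, hr, hle⟩ := exists_near_minimizer (α := 1 - α) (sub_ne_zero.2 hα1.symm)
    (fun h => hα0 (by linarith)) (-G) hθ hδ
  rw [renyiSeq_symm hα0 hα1 hν hθ] at hr
  rw [expTilt_dual_left, expTilt_dual_right, show 1 - α - 1 = -α by ring,
    show 1 - α = -(α - 1) by ring, div_neg, div_neg] at hle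
  exact ⟨ν, hν, r, hr, by linarith⟩

end Variational

/-- The first two conjuncts say that the limits defining the growth rate and the Rényi divergence
rate exist; the third says that the growth rates that occur are finite, so that no expression
`∞ - ∞` arises; the last two are the variational formulas. -/
theorem mainTheorem4 (d : ℕ) (α : ℝ) (hα0 : α ≠ 0) (hα1 : α ≠ 1)
    (G : Matrix (Fin d) (Fin d) ℝ) :
    (∀ M : Matrix (Fin d) (Fin d) ℝ, (∀ i j, 0 ≤ M i j) →
      ∃ l : EReal, Tendsto (growthSeq M) atTop (𝓝 l)) ∧
    (∀ ν ∈ MarkovDist d, ∀ θ ∈ MarkovDist d,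
      ∃ l : EReal, Tendsto (renyiSeq α ν θ) atTop (𝓝 l)) ∧
    (∀ ν ∈ MarkovDist d, ∀ c : ℝ,
      growthRate (expTilt c G ν) ≠ ⊥ ∧ growthRate (expTilt c G ν) ≠ ⊤) ∧
    (∀ ν ∈ MarkovDist d,
      ((1 / (α - 1) : ℝ) : EReal) * growthRate (expTilt (α - 1) G ν) =
        ⨅ θ ∈ MarkovDist d,
          (((1 / α : ℝ) : EReal) * growthRate (expTilt α G θ) + renyiRate α ν θ)) ∧
    (∀ θ ∈ MarkovDist d,
      ((1 / α : ℝ) : EReal) * growthRate (expTilt α G θ) =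
        ⨆ ν ∈ MarkovDist d,
          (((1 / (α - 1) : ℝ) : EReal) * growthRate (expTilt (α - 1) G ν) -
            renyiRate α ν θ)) := by

  have hA := fun {c : ℝ} {ν : Matrix (Fin d) (Fin d) ℝ} (hν : ν ∈ MarkovDist d) =>
    growthRate_expTilt c G hν
  refine ⟨fun M hM => ?_, fun ν hν θ hθ => ?_, fun ν hν c => ?_, fun ν hν => le_antisymm ?_ ?_,
    fun θ hθ => le_antisymm ?_ ?_⟩
  · by_cases h : NonVanishing M
    · exact ⟨_, tendsto_growthSeq hM h⟩
    · exact ⟨_, tendsto_growthSeq_bot hM h⟩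
  · rcases renyiRate_real_or_top hα0 hα1 G hν hθ with h | ⟨r, h, -⟩
    exacts [⟨_, h⟩, ⟨_, h⟩]
  · rw [hA hν]
    exact ⟨EReal.coe_ne_bot _, EReal.coe_ne_top _⟩
  · refine le_iInf₂ fun θ hθ => ?_
    rw [hA hν, hA hθ, ← EReal.coe_mul, ← EReal.coe_mul]
    rcases renyiRate_real_or_top hα0 hα1 G hν hθ with h | ⟨r, h, hle⟩
    · rw [renyiRate, h.limUnder_eq, EReal.coe_add_top]
      exact le_top
    · rw [renyiRate, h.limUnder_eq]
      exact_mod_cast hle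
  · rw [hA hν, ← EReal.coe_mul]
    -- It suffices to reach every real `z` above the value; the gap to `z` serves as the error `δ`.
    refine EReal.le_of_forall_lt_iff_le.1 fun z hz => ?_
    obtain ⟨θ, hθ, r, hr, hle⟩ := exists_near_minimizer hα0 hα1 G hν
      (sub_pos.2 (EReal.coe_lt_coe_iff.1 hz))
    refine (iInf₂_le θ hθ).trans ?_
    rw [hA hθ, ← EReal.coe_mul, renyiRate, hr.limUnder_eq]
    rw [add_sub_cancel] at hle
    exact_mod_cast hle
  · rw [hA hθ, ← EReal.coe_mul]
    refine EReal.ge_of_forall_gt_iff_ge.1 fun z hz => ?_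
    obtain ⟨ν, hν, r, hr, hle⟩ := exists_near_maximizer hα0 hα1 G hθ
      (sub_pos.2 (EReal.coe_lt_coe_iff.1 hz))
    refine le_trans ?_ (le_iSup₂ ν hν)
    rw [hA hν, ← EReal.coe_mul, renyiRate, hr.limUnder_eq]
    rw [sub_sub_cancel] at hle
    exact_mod_cast hle
  · refine iSup₂_le fun ν hν => ?_
    rw [hA hν, hA hθ, ← EReal.coe_mul, ← EReal.coe_mul]
    rcases renyiRate_real_or_top hα0 hα1 G hν hθ with h | ⟨r, h, hle⟩
    · rw [renyiRate, h.limUnder_eq, EReal.sub_top]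
      exact bot_le
    · rw [renyiRate, h.limUnder_eq]
      rw [← sub_le_iff_le_add] at hle
      exact_mod_cast hle
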